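/- Let $T=\{T(x):x\in\mathbb S^2\}$ be a (jointly measurable) real-valued, zero-mean, isotropic Gaussian random field on the unit sphere $\mathbb S^2\subset\mathbb R^3$, i.e. a Gaussian field with $\mathbf E\,T(x)=0$ and $\mathbf E[T(gx)T(gy)]=\mathbf E[T(x)T(y)]$ for all $x,y\in\mathbb S^2$ and $g\in SO(3)$. Let $Y_{lm}$ ($l\ge 0$, $-l\le m\le l$) be the complex orthonormal spherical harmonics, $Y_{lm}(\vartheta,\varphi)=\sqrt{\frac{2l+1}{4\pi}\frac{(l-m)!}{(l+m)!}}\,Q_{lm}(\cos\vartheta)e^{im\varphi}$ with $Q_{lm}(z)=(-1)^m(1-z^2)^{m/2}\frac{d^m}{dz^m}Q_l(z)$ and $Q_l$ the Legendre polynomials (and $Y_{l,-m}=(-1)^mY_{lm}^*$), put $\mu_l=l(l+1)$, and let $a_{lm}=\int_{\mathbb S^2}T(x)Y_{lm}^*(x)\,dx$, where $dx$ is the surface measure. Let $\Pi$ be a measure on $(0,\infty)$ with $\int_0^\infty(1\wedge z)\,\Pi(dz)<\infty$ and $\Pi((0,\infty))=\infty$, whose tail $z\mapsto\Pi((z,\infty))$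 is absolutely continuous on compact subintervals of $(0,\infty)$. Let $H$ be a subordinator with Laplace exponent $\Phi(\lambda)=\int_0^\infty(1-e^{-\lambda z})\,\Pi(dz)$, let $L_t=\inf\{s\ge 0:H_s>t\}$ be its inverse, and let $\widetilde l(t,\lambda)=\mathbf E[e^{-\lambda L_t}]$. Let $\Psi(\lambda)=b\lambda+\int_0^\infty(1-e^{-\lambda z})\,M(dz)$ with $b\ge 0$ and $M$ a measure on $(0,\infty)$ with $\int_0^\infty(1\wedge z)\,M(dz)<\infty$, and let $\gamma\ge 0$, $t\ge 0$. Then for every $x\in\mathbb S^2$ the series $$X_t(x)=\sum_{l=0}^\infty\sum_{m=-l}^{l}a_{lm}\,\widetilde l\big(t,\gamma+\Psi(\mu_l)\big)\,Y_{lm}(x)$$ converges in mean square to a real random variable, and for every $n\in\mathbb N$, every $g\in SO(3)$ and every $x\in\mathbb S^2$ the moment $\mathbf E[(X_t(gx))^n]$ and all the moments $\mathbf E[a_{l_10}\cdots a_{l_n0}]$ exist, and $$\mathbf E\big[(X_t(gx))^n\big]=\sum_{l_1=0}^\infty\cdots\sum_{l_n=0}^\infty\Big(\prod_{j=1}^n\widetilde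 l\big(t,\gamma+\Psi(\mu_{l_j})\big)\Big)\sqrt{\frac{\prod_{j=1}^n(2l_j+1)}{(4\pi)^n}}\;\mathbf E\big[a_{l_10}\cdots a_{l_n0}\big],$$ where the series converges absolutely. In particular the moments are rotation invariant: $\mathbf E[(X_t(gx))^n]=\mathbf E[(X_t(x))^n]$. -/

import Mathlib

open MeasureTheory ProbabilityTheory Filter Topology
open scoped NNReal ENNReal

noncomputable section

namespace SphericalField

/-! ### The sphere, its surface measure and the rotations -/

/-- The unit sphere of `ℝ³`. -/
abbrev S2 : Type := Metric.sphere (0 : EuclideanSpace ℝ (Fin 3)) 1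

/-- The Lebesgue (surface) measure on the unit sphere, of total mass `4π`
(`sin ϑ dϑ dφ` in spherical coordinates). -/
def surface : Measure S2 := (volume : Measure (EuclideanSpace ℝ (Fin 3))).toSphere

/-- The rotation group `SO(3)`. -/
abbrev SO3 : Type := Matrix.specialOrthogonalGroup (Fin 3) ℝ

theorem norm_rotate (g : SO3) (x : EuclideanSpace ℝ (Fin 3)) :
    ‖WithLp.toLp 2 ((g : Matrix (Fin 3) (Fin 3) ℝ).mulVec (WithLp.ofLp x))‖ = ‖x‖ := by
  have h1 := (Matrix.mem_orthogonalGroup_iff' (Fin 3) ℝ).1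
    (Matrix.mem_specialOrthogonalGroup_iff.1 g.2).1
  have h2 : dotProduct ((g : Matrix (Fin 3) (Fin 3) ℝ).mulVec (WithLp.ofLp x))
      ((g : Matrix (Fin 3) (Fin 3) ℝ).mulVec (WithLp.ofLp x))
      = dotProduct (WithLp.ofLp x) (WithLp.ofLp x) := by
    rw [Matrix.dotProduct_mulVec, ← Matrix.mulVec_transpose, Matrix.mulVec_mulVec]
    have h3 : (g : Matrix (Fin 3) (Fin 3) ℝ).transpose * (g : Matrix (Fin 3) (Fin 3) ℝ) = 1 := h1
    rw [h3, Matrix.one_mulVec]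
  rw [EuclideanSpace.norm_eq, EuclideanSpace.norm_eq]
  congr 1
  simpa [dotProduct, sq] using h2

/-- The action of a rotation on a point of the sphere. -/
def rotate (g : SO3) (x : S2) : S2 :=
  ⟨WithLp.toLp 2 ((g : Matrix (Fin 3) (Fin 3) ℝ).mulVec (WithLp.ofLp (x : EuclideanSpace ℝ (Fin 3)))),
    by
      have hx : ‖(x : EuclideanSpace ℝ (Fin 3))‖ = 1 := mem_sphere_zero_iff_norm.1 x.2
      rw [mem_sphere_zero_iff_norm, norm_rotate, hx]⟩

/-! ### Spherical harmonics -/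

/-- The Legendre polynomial `Q_l(z) = (2^l l!)⁻¹ d^l/dz^l (z² - 1)^l`. -/
def legendre (l : ℕ) : Polynomial ℝ :=
  Polynomial.C (((2 : ℝ) ^ l * (l.factorial : ℝ))⁻¹) *
    Polynomial.derivative^[l] ((Polynomial.X ^ 2 - 1) ^ l)

/-- The associated Legendre function
`Q_{lm}(z) = (-1)^m (1 - z²)^{m/2} d^m/dz^m Q_l(z)`, for `m ≥ 0` and `|z| ≤ 1`. -/
def assocLegendre (l m : ℕ) (z : ℝ) : ℝ :=
  (-1) ^ m * Real.sqrt (1 - z ^ 2) ^ m * (Polynomial.derivative^[m] (legendre l)).eval z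

/-- The normalizing constant of the spherical harmonics. -/
def harmonicConst (l m : ℕ) : ℝ :=
  Real.sqrt ((2 * (l : ℝ) + 1) / (4 * Real.pi) *
    (((l - m).factorial : ℝ) / ((l + m).factorial : ℝ)))

/-- The spherical harmonic `Y_{lm}` for `m ≥ 0`, in Cartesian coordinates: in spherical
coordinates `(sin ϑ)^m e^{imφ}` is `(x₀ + i x₁)^m` and `cos ϑ` is `x₂`
(see `harmonicNonneg_spherical`). -/
def harmonicNonneg (l m : ℕ) (x : EuclideanSpace ℝ (Fin 3)) : ℂ :=
  ((harmonicConst l m * ((-1) ^ m * (Polynomial.derivative^[m] (legendre l)).eval (x 2)) : ℝ) : ℂ) *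
    ((x 0 : ℂ) + Complex.I * (x 1 : ℂ)) ^ m

/-- `Y_{lm}(ϑ, φ) = √((2l+1)/(4π) · (l-m)!/(l+m)!) Q_{lm}(cos ϑ) e^{imφ}`. -/
theorem harmonicNonneg_spherical (l m : ℕ) (θ φ : ℝ) (hθ : 0 ≤ θ) (hθ' : θ ≤ Real.pi) :
    harmonicNonneg l m
        (!₂[Real.sin θ * Real.cos φ, Real.sin θ * Real.sin φ, Real.cos θ]) =
      (harmonicConst l m : ℂ) * (assocLegendre l m (Real.cos θ) : ℂ) *
        Complex.exp (Complex.I * (m : ℂ) * (φ : ℂ)) := by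
  have hs : Real.sqrt (1 - Real.cos θ ^ 2) = Real.sin θ := by
    rw [← Real.sin_sq, Real.sqrt_sq (Real.sin_nonneg_of_nonneg_of_le_pi hθ hθ')]
  have he : Complex.exp (Complex.I * (m : ℂ) * (φ : ℂ)) =
      (Complex.cos φ + Complex.sin φ * Complex.I) ^ m := by
    rw [← Complex.exp_mul_I, ← Complex.exp_nat_mul]
    congr 1
    ring
  rw [he]
  simp only [harmonicNonneg, assocLegendre, hs]
  simp
  rw [show (Complex.sin θ * Complex.cos φ + Complex.I * (Complex.sin θ * Complex.sin φ)) =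
    Complex.sin θ * (Complex.cos φ + Complex.sin φ * Complex.I) by ring, mul_pow]
  ring

/-- The complex spherical harmonic `Y_{lm}`, `-l ≤ m ≤ l`, on the sphere, with
`Y_{l,-m} = (-1)^m (Y_{lm})^*`. -/
def harmonic (l : ℕ) (m : ℤ) (x : S2) : ℂ :=
  if 0 ≤ m then harmonicNonneg l m.toNat x
  else (-1) ^ m.natAbs * (starRingEnd ℂ) (harmonicNonneg l m.natAbs x)

/-- The eigenvalue `μ_l = l (l + 1)` of the negative of the Laplace-Beltrami operator. -/
def eigenvalue (l : ℕ) : ℝ := (l : ℝ) * ((l : ℝ) + 1)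

/-! ### Subordinators, their inverses and Bernstein functions -/

/-- `ν` is the Lévy measure of a subordinator: a measure carried by `(0, ∞)` such that
`∫ (1 ∧ z) ν(dz) < ∞`. -/
structure IsLevyMeasure (ν : Measure ℝ) : Prop where
  support : ν (Set.Iic 0) = 0
  integrable : ∫⁻ z, ENNReal.ofReal (min 1 z) ∂ν < ∞

/-- The Bernstein function `λ ↦ b λ + ∫ (1 - e^{-λ z}) ν(dz)`. -/
def bernstein (b : ℝ) (ν : Measure ℝ) (r : ℝ) : ℝ :=
  b * r + ∫ z, (1 - Real.exp (-r * z)) ∂ν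

/-- The tail `z ↦ ν((z, ∞))` of `ν`. -/
def tail (ν : Measure ℝ) (z : ℝ) : ℝ := (ν (Set.Ioi z)).toReal

/-- `H` is a subordinator with Laplace exponent `Φ` on the probability space `(Ω', Q)`: a Lévy
process started at `0` with almost surely nondecreasing right-continuous paths and
`E[exp(-λ H_s)] = exp(-s Φ(λ))`. -/
structure IsSubordinator {Ω' : Type*} [MeasurableSpace Ω'] (H : ℝ≥0 → Ω' → ℝ) (Q : Measure Ω')
    (Φ : ℝ → ℝ) : Prop where
  measurable : ∀ s, Measurable (H s)
  start : ∀ᵐ ω ∂Q, H 0 ω = 0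
  monotone : ∀ᵐ ω ∂Q, Monotone fun s => H s ω
  right_continuous : ∀ᵐ ω ∂Q, ∀ s, ContinuousWithinAt (fun u => H u ω) (Set.Ici s) s
  indep_increments : HasIndepIncrements H Q
  stationary_increments : ∀ s u : ℝ≥0, IdentDistrib (fun ω => H (s + u) ω - H s ω) (H u) Q Q
  laplace : ∀ (s : ℝ≥0) (r : ℝ), 0 ≤ r → ∫ ω, Real.exp (-r * H s ω) ∂Q = Real.exp (-(s : ℝ) * Φ r)

/-- The inverse process `L_t = inf {s ≥ 0 : H_s > t}`. -/
def inverse {Ω' : Type*} (H : ℝ≥0 → Ω' → ℝ) (t : ℝ) (ω : Ω') : ℝ :=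
  ((sInf {s : ℝ≥0 | t < H s ω} : ℝ≥0) : ℝ)

/-- The Laplace transform `E[exp(-λ L_t)]` of the inverse process at time `t`. -/
def inverseLaplace {Ω' : Type*} [MeasurableSpace Ω'] (H : ℝ≥0 → Ω' → ℝ) (Q : Measure Ω')
    (t r : ℝ) : ℝ :=
  ∫ ω, Real.exp (-r * inverse H t ω) ∂Q

/-! ### Random fields on the sphere -/

/-- `T` is a (measurable) real, zero-mean, isotropic Gaussian random field on the sphere.
(A Gaussian field has finite second moments.) -/
structure IsIsotropicGaussianField {Ω : Type*} [MeasurableSpace Ω] (T : S2 → Ω → ℝ)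
    (P : Measure Ω) : Prop where
  measurable : Measurable fun p : S2 × Ω => T p.1 p.2
  gaussian : IsGaussianProcess T P
  mean_zero : ∀ x, ∫ ω, T x ω ∂P = 0
  isotropic : ∀ (g : SO3) (x y : S2),
    ∫ ω, T (rotate g x) ω * T (rotate g y) ω ∂P = ∫ ω, T x ω * T y ω ∂P

/-- The random Fourier coefficient `a_{lm} = ∫ T(x) Y_{lm}^*(x) dx`. -/
def coeff {Ω : Type*} (T : S2 → Ω → ℝ) (l : ℕ) (m : ℤ) (ω : Ω) : ℂ :=
  ∫ x, (T x ω : ℂ) * (starRingEnd ℂ) (harmonic l m x) ∂surface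

/-- The real random field `X` is the sum of the series
`∑_{l ≥ 0} ∑_{|m| ≤ l} a_{lm} w_l Y_{lm}(x)`, where the `a_{lm}` are the Fourier coefficients
of `T`; for every `x` the series converges in mean square. -/
def IsSeriesField {Ω : Type*} [MeasurableSpace Ω] (P : Measure Ω) (T : S2 → Ω → ℝ) (w : ℕ → ℝ)
    (X : S2 → Ω → ℝ) : Prop :=
  ∀ x : S2, MemLp (X x) 2 P ∧
    Tendsto (fun N : ℕ => eLpNorm (fun ω => (X x ω : ℂ) -
        ∑ l ∈ Finset.range (N + 1), ∑ m ∈ Finset.Icc (-(l : ℤ)) (l : ℤ),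
          coeff T l m ω * (w l : ℂ) * harmonic l m x) 2 P) atTop (𝓝 0)

end SphericalField

end

/-!
The weights `w l` lie in `[0, 1]`, since `L_t` and the argument `γ + Ψ(μ_l)` are nonnegative. With
this bound, the claim becomes one about the field `T`.

Write `τ_l(x) = ∑_m a_{lm} Y_{lm}(x)` for the component of degree `l` (`component`). Almost surely
`τ_l(x) = ∫ T(y) Z_l(x, y) dy`, where `Z_l(x, y) = ∑_m Y_{lm}(x) Y_{lm}(y)^*` is the zonal kernel.

*Harmonic analysis.* The `Y_{lm}` are orthonormal (`integral_harmonic`), and those of degree at most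
`N` span the restrictions to the sphere of all polynomials of degree at most `N`
(`harmonicSpan_eq`), a rotation invariant space. A reproducing kernel does not depend on the
orthonormal basis, so `Z_l(gx, gy) = Z_l(x, y)` (`zonalC_rotate`). At the north pole only `m = 0`
contributes to `τ_l`, which there equals `√((2l+1)/(4π)) a_{l0}` (`component_pole`).

*Probability.* By Fubini, `∫ T(y) f(y) dy` is orthogonal to whatever is orthogonal to all `T(y)`, so
it belongs to the closed linear span of the field in `L²`, whose members are centered Gaussian
variables (`map_eq_gaussianReal_of_mem_gaussianSpan`). Isotropy makes `E[τ_l(x) τ_l'(x)]`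
independent of `x`. Averaging it over the sphere shows that components of different degrees are
uncorrelated, and, with Bessel's inequality, that their variances are summable
(`summable_componentVariance`). Hence the series converges in mean square, to a Gaussian variable whose variance does not depend on
the point.

*Moments.* The term of the moment series at `(l_1, …, l_n)` is `∏ w(l_j) E[∏ τ_{l_j}(pole)]`. It is
nonnegative, since uncorrelated members of a Gaussian space are independent and the moments of a
centered Gaussian variable are nonnegative. Sums over boxes `{0, …, N}^n` are the `n`-th moments of
the partial sums of the field at the pole, that is powers of their standard deviations times the
moment of the standard normal law, and converge to the `n`-th moment of `X(x)` for every `x`. For a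
series of nonnegative terms this is absolute convergence.
-/

noncomputable section

namespace SphericalField

/-! ### Rotations and the surface measure -/

theorem rotate_apply (g : SO3) (x : S2) (i : Fin 3) :
    (rotate g x).1 i = ∑ j, (g : Matrix (Fin 3) (Fin 3) ℝ) i j * x.1 j := rfl

theorem rotate_mul (g h : SO3) (x : S2) : rotate (g * h) x = rotate g (rotate h x) := by
  ext i
  simp [rotate, Matrix.mulVec_mulVec]

theorem rotate_one (x : S2) : rotate 1 x = x := by
  ext i
  simp [rotate]

theorem continuous_coord (i : Fin 3) : Continuous fun x : S2 => x.1 i := by fun_prop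

theorem continuous_rotate (g : SO3) : Continuous (rotate g) := by
  refine Continuous.subtype_mk ?_ _
  refine (PiLp.continuous_toLp 2 _).comp ?_
  refine Continuous.matrix_mulVec continuous_const ?_
  exact (PiLp.continuous_ofLp 2 _).comp continuous_subtype_val

/-- The action of a rotation on `ℝ³`, as a linear isometry. -/
def rotateIsometry (g : SO3) : EuclideanSpace ℝ (Fin 3) →ₗᵢ[ℝ] EuclideanSpace ℝ (Fin 3) where
  toFun x := WithLp.toLp 2 ((g : Matrix (Fin 3) (Fin 3) ℝ).mulVec (WithLp.ofLp x))
  map_add' x y := by simp [Matrix.mulVec_add]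
  map_smul' c x := by simp [Matrix.mulVec_smul]
  norm_map' x := norm_rotate g x

/-- The action of a rotation on the sphere, as a measurable equivalence. -/
def rotateEquiv (g : SO3) : S2 ≃ᵐ S2 where
  toFun := rotate g
  invFun := rotate g⁻¹
  left_inv x := by rw [← rotate_mul, inv_mul_cancel, rotate_one]
  right_inv x := by rw [← rotate_mul, mul_inv_cancel, rotate_one]
  measurable_toFun := (continuous_rotate g).measurable
  measurable_invFun := (continuous_rotate g⁻¹).measurable

open scoped Pointwise in
theorem measurePreserving_rotate (g : SO3) : MeasurePreserving (rotate g) surface surface := by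
  refine ⟨(continuous_rotate g).measurable, ?_⟩
  ext s hs
  rw [Measure.map_apply (continuous_rotate g).measurable hs, surface,
    Measure.toSphere_apply' _ hs,
    Measure.toSphere_apply' _ ((continuous_rotate g).measurable hs)]
  congr 1
  have hmp := ((rotateIsometry g).toLinearIsometryEquiv rfl).measurePreserving
  rw [← hmp.measure_preimage_equiv (f := ((rotateIsometry g).toLinearIsometryEquiv
    rfl).toHomeomorph.toMeasurableEquiv) (Set.Ioo (0 : ℝ) 1 • (Subtype.val '' s))]
  congr 1
  ext y
  simp only [Set.mem_smul, Set.mem_image, Set.mem_preimage]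
  constructor
  · rintro ⟨r, hr, _, ⟨x, hx, rfl⟩, rfl⟩
    exact ⟨r, hr, _, ⟨rotate g x, hx, rfl⟩, ((rotateIsometry g).map_smul r x.1).symm⟩
  · rintro ⟨r, hr, _, ⟨x, hx, rfl⟩, h⟩
    refine ⟨r, hr, _, ⟨rotate g⁻¹ x, ?_, rfl⟩, ?_⟩
    · rwa [← rotate_mul, mul_inv_cancel, rotate_one]
    · apply (rotateIsometry g).injective
      rw [LinearIsometry.map_smul]
      have : rotateIsometry g (rotate g⁻¹ x).1 = x.1 :=
        congrArg Subtype.val ((rotateEquiv g).right_inv x)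
      rw [this]; exact h

theorem integral_rotate {E : Type*} [NormedAddCommGroup E] [NormedSpace ℝ E] (g : SO3)
    (f : S2 → E) : ∫ x, f (rotate g x) ∂surface = ∫ x, f x ∂surface :=
  (measurePreserving_rotate g).integral_comp (rotateEquiv g).measurableEmbedding f

instance : IsFiniteMeasure surface := by unfold surface; infer_instance

theorem surface_real_univ : surface.real Set.univ = 4 * Real.pi := by
  rw [surface, Measure.toSphere_real_apply_univ, measureReal_def,
    EuclideanSpace.volume_ball_fin_three]
  have h : 0 ≤ Real.pi * (4 / 3) := by positivity
  simp [← mul_div_assoc] at h ⊢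
  ring_nf at h ⊢
  rw [ENNReal.toReal_ofReal h]
  ring

theorem integrable_of_continuous {E : Type*} [NormedAddCommGroup E] {f : S2 → E}
    (hf : Continuous f) : Integrable f surface :=
  hf.integrable_of_hasCompactSupport (HasCompactSupport.of_compactSpace f)

/-- The rotation by the angle `θ` about the polar axis. -/
def rotZ (θ : ℝ) : SO3 :=
  ⟨!![Real.cos θ, -Real.sin θ, 0; Real.sin θ, Real.cos θ, 0; 0, 0, 1], by
    rw [Matrix.mem_specialOrthogonalGroup_iff, Matrix.mem_orthogonalGroup_iff]
    constructor
    · ext i j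
      have := Real.sin_sq_add_cos_sq θ
      fin_cases i <;> fin_cases j <;>
        simp [Matrix.mul_apply, Fin.sum_univ_three] <;> linarith
    · have := Real.sin_sq_add_cos_sq θ
      simp [Matrix.det_fin_three]; linarith⟩

/-- The rotation by the angle `θ` in the plane of the first and the third coordinates. -/
def rotY (θ : ℝ) : SO3 :=
  ⟨!![Real.cos θ, 0, Real.sin θ; 0, 1, 0; -Real.sin θ, 0, Real.cos θ], by
    rw [Matrix.mem_specialOrthogonalGroup_iff, Matrix.mem_orthogonalGroup_iff]
    constructor
    · ext i j
      have := Real.sin_sq_add_cos_sq θ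
      fin_cases i <;> fin_cases j <;>
        simp [Matrix.mul_apply, Fin.sum_univ_three] <;> linarith
    · have := Real.sin_sq_add_cos_sq θ
      simp [Matrix.det_fin_three]; linarith⟩

theorem rotZ_zero (θ : ℝ) (x : S2) :
    (rotate (rotZ θ) x).1 0 = Real.cos θ * x.1 0 - Real.sin θ * x.1 1 := by
  simp [rotate_apply, rotZ, Fin.sum_univ_three]; ring

theorem rotZ_one (θ : ℝ) (x : S2) :
    (rotate (rotZ θ) x).1 1 = Real.sin θ * x.1 0 + Real.cos θ * x.1 1 := by
  simp [rotate_apply, rotZ, Fin.sum_univ_three]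

theorem rotZ_two (θ : ℝ) (x : S2) : (rotate (rotZ θ) x).1 2 = x.1 2 := by
  simp [rotate_apply, rotZ, Fin.sum_univ_three]

theorem rotY_zero (θ : ℝ) (x : S2) :
    (rotate (rotY θ) x).1 0 = Real.cos θ * x.1 0 + Real.sin θ * x.1 2 := by
  simp [rotate_apply, rotY, Fin.sum_univ_three]

theorem rotY_one (θ : ℝ) (x : S2) : (rotate (rotY θ) x).1 1 = x.1 1 := by
  simp [rotate_apply, rotY, Fin.sum_univ_three]

theorem rotY_two (θ : ℝ) (x : S2) :
    (rotate (rotY θ) x).1 2 = Real.cos θ * x.1 2 - Real.sin θ * x.1 0 := by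
  simp [rotate_apply, rotY, Fin.sum_univ_three]; ring

theorem sum_sq_coord (x : S2) : x.1 0 ^ 2 + x.1 1 ^ 2 + x.1 2 ^ 2 = 1 := by
  have hx : ‖x.1‖ = 1 := mem_sphere_zero_iff_norm.1 x.2
  have := EuclideanSpace.norm_sq_eq x.1
  simpa [hx, Fin.sum_univ_three] using this.symm

/-- The north pole. -/
def pole : S2 := ⟨!₂[0, 0, 1], by simp [EuclideanSpace.norm_eq, Fin.sum_univ_three]⟩

/-- `SO(3)` acts transitively on the sphere: the rotation is read off from the spherical
coordinates of `x`. -/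
theorem exists_rotate_pole (x : S2) : ∃ g : SO3, rotate g pole = x := by
  have hx := sum_sq_coord x
  have hz : x.1 2 ∈ Set.Icc (-1) 1 := abs_le.1 (abs_le_one_iff_mul_self_le_one.2 (by nlinarith))
  set z : ℂ := ⟨x.1 0, x.1 1⟩ with hzdef
  have hn : ‖z‖ = Real.sqrt (1 - x.1 2 ^ 2) := by
    rw [Complex.norm_eq_sqrt_sq_add_sq]; congr 1; simp [hzdef]; linarith
  refine ⟨rotZ z.arg * rotY (Real.arccos (x.1 2)), ?_⟩
  rw [rotate_mul]
  have h0 : pole.1 0 = 0 := by simp [pole]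
  have h1 : pole.1 1 = 0 := by simp [pole]
  have h2 : pole.1 2 = 1 := by simp [pole]
  have hc := Complex.norm_mul_cos_arg z
  have hs := Complex.norm_mul_sin_arg z
  rw [hn] at hc hs
  ext i
  fin_cases i
  · simp only [Fin.zero_eta, rotZ_zero, rotY_zero, rotY_one, h0, h1, h2, Real.sin_arccos]
    linarith
  · simp only [Fin.mk_one, rotZ_one, rotY_zero, rotY_one, h0, h1, h2, Real.sin_arccos]
    linarith
  · simp only [Fin.reduceFinMk, rotZ_two, rotY_two, h0, h2, Real.cos_arccos hz.1 hz.2]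
    ring

/-- Infinitesimal rotation invariance of the surface measure: the integral of `z ^ n * x`, rotated
by `θ` in the plane of `x` and `z`, does not depend on `θ`, so its derivative at `0` vanishes. -/
theorem integral_pow_succ_eq (n : ℕ) :
    ∫ x, x.1 2 ^ (n + 1) ∂surface = n * ∫ x, x.1 2 ^ (n - 1) * x.1 0 ^ 2 ∂surface := by
  set F : ℝ → S2 → ℝ := fun θ x => (rotate (rotY θ) x).1 2 ^ n * (rotate (rotY θ) x).1 0
  set F' : ℝ → S2 → ℝ := fun θ x => (rotate (rotY θ) x).1 2 ^ (n + 1) -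
    n * ((rotate (rotY θ) x).1 2 ^ (n - 1) * (rotate (rotY θ) x).1 0 ^ 2)
  have hcont : ∀ θ i, Continuous fun x : S2 => (rotate (rotY θ) x).1 i := fun θ i =>
    (continuous_coord i).comp (continuous_rotate _)
  have hF : ∀ θ, Continuous (F θ) := fun θ => ((hcont θ 2).pow n).mul (hcont θ 0)
  have hF' : ∀ θ, Continuous (F' θ) := fun θ => ((hcont θ 2).pow _).sub
    (continuous_const.mul (((hcont θ 2).pow _).mul ((hcont θ 0).pow 2)))
  have habs : ∀ (y : S2) i, |y.1 i| ≤ 1 := by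
    intro y i
    have := sum_sq_coord y
    rw [abs_le_one_iff_mul_self_le_one]
    fin_cases i <;> simp only [Fin.zero_eta, Fin.mk_one, Fin.reduceFinMk] <;>
      nlinarith [sq_nonneg (y.1 0), sq_nonneg (y.1 1), sq_nonneg (y.1 2)]
  have hder := (hasDerivAt_integral_of_dominated_loc_of_deriv_le (μ := surface) (F := F)
    (F' := F') (x₀ := 0) (s := Set.univ) (bound := fun _ => 1 + n) univ_mem
    (Eventually.of_forall fun θ => (hF θ).aestronglyMeasurable)
    (integrable_of_continuous (hF 0)) (hF' 0).aestronglyMeasurable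
    (ae_of_all _ fun x θ _ => by
      have h2 := habs (rotate (rotY θ) x) 2
      have h0 := habs (rotate (rotY θ) x) 0
      refine (abs_sub _ _).trans ?_
      rw [abs_mul, abs_mul, abs_pow, abs_pow, abs_pow, Nat.abs_cast]
      have e1 := pow_le_one₀ (abs_nonneg _) h2 (n := n + 1)
      have e2 := pow_le_one₀ (abs_nonneg _) h2 (n := n - 1)
      have e3 := pow_le_one₀ (abs_nonneg _) h0 (n := 2)
      have e4 := mul_le_one₀ e2 (by positivity) e3
      have e5 := mul_le_of_le_one_right (Nat.cast_nonneg (α := ℝ) n) e4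
      linarith)
    (integrable_const _)
    (ae_of_all _ fun x θ _ => by
      have d2 : HasDerivAt (fun θ => (rotate (rotY θ) x).1 2) (-(rotate (rotY θ) x).1 0) θ := by
        simp only [rotY_two, rotY_zero]
        convert! ((Real.hasDerivAt_cos θ).mul_const (x.1 2)).sub
          ((Real.hasDerivAt_sin θ).mul_const (x.1 0)) using 1
        ring
      have d0 : HasDerivAt (fun θ => (rotate (rotY θ) x).1 0) ((rotate (rotY θ) x).1 2) θ := by
        simp only [rotY_two, rotY_zero]
        convert! ((Real.hasDerivAt_cos θ).mul_const (x.1 0)).add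
          ((Real.hasDerivAt_sin θ).mul_const (x.1 2)) using 1
        ring
      convert! (d2.pow n).mul d0 using 1
      simp only [F', Pi.pow_apply]
      ring)).2
  have hconst : (fun θ => ∫ x, F θ x ∂surface) = fun _ => ∫ x, x.1 2 ^ n * x.1 0 ∂surface :=
    funext fun θ => integral_rotate (rotY θ) (fun x => x.1 2 ^ n * x.1 0)
  rw [hconst] at hder
  have h0 := hder.unique (hasDerivAt_const _ _)
  have h1 := integral_rotate (rotY 0) (fun x => x.1 2 ^ (n + 1) - n * (x.1 2 ^ (n - 1) * x.1 0 ^ 2))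
  rw [h0, integral_sub, integral_const_mul] at h1
  · linarith
  · exact integrable_of_continuous (by fun_prop)
  · exact integrable_of_continuous (by fun_prop)

theorem integral_pow_mul_sq (n : ℕ) :
    2 * ∫ x, x.1 2 ^ n * x.1 0 ^ 2 ∂surface =
      ∫ x, x.1 2 ^ n ∂surface - ∫ x, x.1 2 ^ (n + 2) ∂surface := by
  have h := integral_rotate (rotZ (Real.pi / 2)) (fun x => x.1 2 ^ n * x.1 0 ^ 2)
  simp only [rotZ_two, rotZ_zero] at h
  simp at h
  rw [← integral_sub (integrable_of_continuous (by fun_prop))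
    (integrable_of_continuous (by fun_prop)), two_mul]
  nth_rw 2 [← h]
  rw [← integral_add (integrable_of_continuous (by fun_prop))
    (integrable_of_continuous (by fun_prop))]
  congr 1
  ext x
  linear_combination x.1 2 ^ n * sum_sq_coord x

theorem integral_pow_eq (n : ℕ) :
    ∫ x, x.1 2 ^ n ∂surface = 2 * Real.pi * ((1 - (-1) ^ (n + 1)) / (n + 1)) := by
  induction n using Nat.twoStepInduction with
  | zero => simp [surface_real_univ]; ring
  | one => simpa using integral_pow_succ_eq 0
  | more n ih _ =>
    have h1 := integral_pow_succ_eq (n + 1)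
    have h2 := integral_pow_mul_sq n
    simp only [Nat.add_sub_cancel] at h1
    rw [ih] at h2
    push_cast at h1 h2 ⊢
    have h3 : ((n : ℝ) + 3) * ∫ x, x.1 2 ^ (n + 2) ∂surface =
        ((n : ℝ) + 1) * (2 * Real.pi * ((1 - (-1) ^ (n + 1)) / (n + 1))) := by
      linear_combination 2 * h1 + (n + 1) * h2
    have h4 : (n : ℝ) + 1 ≠ 0 := by positivity
    have h5 : (n : ℝ) + 3 ≠ 0 := by positivity
    have h6 : (n : ℝ) + 2 + 1 ≠ 0 := by positivity
    field_simp at h3 ⊢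
    rw [show n + 2 + 1 = (n + 1) + 2 by ring, pow_add _ (n + 1) 2]
    linear_combination h3

open Polynomial in
/-- Archimedes' hat-box theorem, tested on polynomials: the third coordinate is uniformly
distributed on `[-1, 1]`.
All integrals of polynomials in this coordinate, and their integrations by parts, come from here. -/
theorem integral_derivative (q : ℝ[X]) :
    ∫ x, (derivative q).eval (x.1 2) ∂surface = 2 * Real.pi * (q.eval 1 - q.eval (-1)) := by
  induction q using Polynomial.induction_on' with
  | add p q hp hq =>
    simp only [derivative_add, eval_add]
    rw [integral_add (integrable_of_continuous (by fun_prop))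
      (integrable_of_continuous (by fun_prop)), hp, hq]
    ring
  | monomial n a =>
    rcases n with _ | n
    · simp
    · simp only [derivative_monomial, eval_monomial, Nat.add_sub_cancel]
      rw [integral_const_mul, integral_pow_eq]
      push_cast
      field_simp
      simp

/-! ### Legendre polynomials -/

open Polynomial in
/-- The differential equation satisfied by the `k`-th derivative of `(z² - 1)^l`. -/
theorem rodrigues_ode (l k : ℕ) :
    (X ^ 2 - 1) * derivative^[k + 2] ((X ^ 2 - 1 : ℝ[X]) ^ l) +
      C (2 * ((k : ℝ) + 1 - l)) * X * derivative^[k + 1] ((X ^ 2 - 1 : ℝ[X]) ^ l) +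
      C (((k : ℝ) + 1) * (k - 2 * l)) * derivative^[k] ((X ^ 2 - 1 : ℝ[X]) ^ l) = 0 := by
  have hC2 : (C (2 : ℝ) : ℝ[X]) = 2 := map_ofNat C 2
  induction k with
  | zero =>
    rcases l with _ | l
    · simp
    · have h : derivative ((X ^ 2 - 1 : ℝ[X]) ^ (l + 1)) =
          C (2 * ((l : ℝ) + 1)) * X * (X ^ 2 - 1) ^ l := by
        rw [derivative_pow]
        simp [hC2]
        ring
      have h1 : (X ^ 2 - 1) * derivative ((X ^ 2 - 1 : ℝ[X]) ^ (l + 1)) =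
          C (2 * ((l : ℝ) + 1)) * X * (X ^ 2 - 1) ^ (l + 1) := by
        rw [h]; ring
      have h2 := congrArg derivative h1
      simp only [derivative_mul, derivative_C, derivative_X, derivative_sub, derivative_X_pow,
        derivative_one] at h2
      simp only [Function.iterate_succ, Function.iterate_zero, Function.comp_apply, id]
      simp at h2 ⊢
      linear_combination h2
  | succ k ih =>
    have h2 := congrArg derivative ih
    simp only [derivative_mul, derivative_add, derivative_C, derivative_X, derivative_sub,
      derivative_X_pow, derivative_one, derivative_zero,
      ← Function.iterate_succ_apply' derivative] at h2
    simp only [Nat.succ_eq_add_one, show k + 2 + 1 = k + 1 + 2 by ring,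
      show k + 1 + 1 = k + 2 by ring] at h2 ⊢
    simp [hC2] at h2 ⊢
    linear_combination h2

open Polynomial in
/-- The Legendre equation, differentiated `m` times. -/
theorem legendre_ode (l m : ℕ) :
    (X ^ 2 - 1) * derivative^[m + 2] (legendre l) +
      C (2 * ((m : ℝ) + 1)) * X * derivative^[m + 1] (legendre l) =
      C (((l : ℝ) - m) * (l + m + 1)) * derivative^[m] (legendre l) := by
  have hC2 : (C (2 : ℝ) : ℝ[X]) = 2 := map_ofNat C 2
  have h := rodrigues_ode l (l + m)
  simp only [legendre, iterate_derivative_C_mul, ← Function.iterate_add_apply]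
  rw [show m + 2 + l = l + m + 2 by ring, show m + 1 + l = l + m + 1 by ring, add_comm m l]
  push_cast at h
  simp [hC2] at h ⊢
  linear_combination (C (((2 : ℝ) ^ l)⁻¹) * C ((l.factorial : ℝ)⁻¹)) * h

open Polynomial in
/-- The Legendre equation in divergence form, which lowers the order `m` by one after an
integration by parts. -/
theorem derivative_legendre_weight (l m : ℕ) :
    derivative ((1 - X ^ 2) ^ (m + 1) * derivative^[m + 1] (legendre l)) =
      -C (((l : ℝ) - m) * (l + m + 1)) * ((1 - X ^ 2) ^ m * derivative^[m] (legendre l)) := by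
  have hC2 : (C (2 : ℝ) : ℝ[X]) = 2 := map_ofNat C 2
  have h := legendre_ode l m
  rw [derivative_mul, derivative_pow, ← Function.iterate_succ_apply' derivative]
  simp [hC2] at h ⊢
  linear_combination (-(1 - X ^ 2) ^ m) * h

open Polynomial in
theorem iterate_derivative_rodrigues_eval (l k : ℕ) (hk : k < l) (s : ℝ) (hs : s ^ 2 = 1) :
    (derivative^[k] ((X ^ 2 - 1 : ℝ[X]) ^ l)).eval s = 0 := by
  have h := pow_sub_dvd_iterate_derivative_of_pow_dvd (p := (X ^ 2 - 1 : ℝ[X]) ^ l)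
    (q := X ^ 2 - 1) k dvd_rfl
  obtain ⟨q, hq⟩ := h
  rw [hq]
  simp [hs, Nat.sub_ne_zero_of_lt hk]

open Polynomial in
theorem natDegree_legendre_le (l : ℕ) : (legendre l).natDegree ≤ l := by
  refine (natDegree_C_mul_le _ _).trans ((natDegree_iterate_derivative _ _).trans ?_)
  have : ((X ^ 2 - 1 : ℝ[X]) ^ l).natDegree ≤ l * 2 :=
    natDegree_pow_le_of_le l (by compute_degree)
  omega

open Polynomial in
theorem coeff_legendre_ne_zero (l : ℕ) : (legendre l).coeff l ≠ 0 := by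
  rw [legendre, coeff_C_mul, coeff_iterate_derivative]
  have : ((X ^ 2 - 1 : ℝ[X]) ^ l).coeff (l + l) = 1 := by
    have hm : ((X ^ 2 - 1 : ℝ[X])).Monic := by monicity!
    have h2 : ((X ^ 2 - 1 : ℝ[X]) ^ l).natDegree = l + l := by
      rw [hm.natDegree_pow, show (X ^ 2 - 1 : ℝ[X]).natDegree = 2 by compute_degree!]; ring
    rw [← h2]; exact (hm.pow l).coeff_natDegree
  rw [this]
  have : (l + l).descFactorial l ≠ 0 := by
    rw [Ne, Nat.descFactorial_eq_zero_iff_lt]; omega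
  simp [Nat.factorial_ne_zero, this]

open Polynomial in
theorem legendre_eval_one (l : ℕ) : (legendre l).eval 1 = 1 := by
  have key : (derivative^[l] ((X ^ 2 - 1 : ℝ[X]) ^ l)).eval 1 = 2 ^ l * l.factorial := by
    have : (X ^ 2 - 1 : ℝ[X]) ^ l = (X - C 1) ^ l * (X + 1) ^ l := by
      rw [← mul_pow]; congr 1; simp; ring
    rw [this, iterate_derivative_mul, eval_finsetSum, Finset.sum_eq_single 0]
    · rw [Nat.sub_zero, iterate_derivative_X_sub_pow_self]
      simp
      norm_num
      ring
    · intro b hb hb0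
      rw [iterate_derivative_X_sub_pow]
      simp at hb ⊢
      right; left; right
      omega
    · simp
  rw [legendre, eval_mul, eval_C, key]
  have := Nat.factorial_ne_zero l
  field_simp

open Polynomial in
theorem legendre_eval_neg_one (l : ℕ) : (legendre l).eval (-1) = (-1) ^ l := by
  have h : (legendre l).comp (-X) = C ((-1) ^ l) * legendre l := by
    have h1 : ∀ (k : ℕ) (p : ℝ[X]), p.comp (-X) = p →
        (derivative^[k] p).comp (-X) = C ((-1) ^ k) * derivative^[k] p := by
      intro k p hp
      induction k with
      | zero => simpa
      | succ k ih =>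
        have := congrArg derivative ih
        rw [derivative_comp, derivative_C_mul] at this
        simp only [Function.iterate_succ_apply'] at this ⊢
        simp at this ⊢
        rw [pow_succ]
        linear_combination -this
    rw [legendre, mul_comp, h1 _ _ (by simp)]
    simp; ring
  have := congrArg (eval 1) h
  simpa [legendre_eval_one] using this

/-! ### Orthonormality of the spherical harmonics -/

open Polynomial in
theorem integral_derivative_mul (p q : ℝ[X]) (h1 : (p * q).eval 1 = 0)
    (h2 : (p * q).eval (-1) = 0) :
    ∫ x, (derivative p * q).eval (x.1 2) ∂surface =
      -∫ x, (p * derivative q).eval (x.1 2) ∂surface := by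
  have h := integral_derivative (p * q)
  rw [h1, h2, derivative_mul] at h
  simp only [eval_add] at h
  rw [integral_add (integrable_of_continuous (by fun_prop))
    (integrable_of_continuous (by fun_prop))] at h
  linarith

open Polynomial in
theorem integral_iterate_derivative_rodrigues_mul (l k : ℕ) (hk : k ≤ l) (q : ℝ[X]) :
    ∫ x, (derivative^[k] ((X ^ 2 - 1 : ℝ[X]) ^ l) * q).eval (x.1 2) ∂surface =
      (-1) ^ k * ∫ x, ((X ^ 2 - 1 : ℝ[X]) ^ l * derivative^[k] q).eval (x.1 2) ∂surface := by
  induction k generalizing q with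
  | zero => simp
  | succ k ih =>
    rw [Function.iterate_succ_apply', integral_derivative_mul, ih (by omega), pow_succ,
      Function.iterate_succ_apply]
    · ring
    · rw [eval_mul, iterate_derivative_rodrigues_eval l k hk 1 (by norm_num), zero_mul]
    · rw [eval_mul, iterate_derivative_rodrigues_eval l k hk (-1) (by norm_num), zero_mul]

open Polynomial in
theorem integral_legendre_mul_eq_zero (l : ℕ) (q : ℝ[X]) (hq : derivative^[l] q = 0) :
    ∫ x, (legendre l * q).eval (x.1 2) ∂surface = 0 := by
  have h := integral_iterate_derivative_rodrigues_mul l l le_rfl q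
  rw [hq] at h
  have e : ∀ x : S2, (legendre l * q).eval (x.1 2) = ((2 : ℝ) ^ l * (l.factorial : ℝ))⁻¹ *
      (derivative^[l] ((X ^ 2 - 1 : ℝ[X]) ^ l) * q).eval (x.1 2) := by
    intro x; rw [legendre, mul_assoc, eval_mul, eval_C]
  simp only [e]
  rw [integral_const_mul, h]
  simp

open Polynomial in
/-- The norm of the Legendre polynomial comes from integrating the derivative of `z Q_l²`: the
polynomial `z Q_l' - l Q_l` has degree less than `l`, hence is orthogonal to `Q_l`. -/
theorem integral_legendre_sq (l : ℕ) :
    ∫ x, (legendre l * legendre l).eval (x.1 2) ∂surface = 4 * Real.pi / (2 * l + 1) := by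
  have h := integral_derivative (X * (legendre l * legendre l))
  have hq := integral_legendre_mul_eq_zero l (X * derivative (legendre l) - C (l : ℝ) * legendre l)
    (by
      ext n
      rw [coeff_iterate_derivative, coeff_sub, coeff_C_mul, coeff_zero]
      have : (X * derivative (legendre l)).coeff (n + l) =
          (n + l) * (legendre l).coeff (n + l) := by
        rcases h : n + l with _ | k
        · have : (n : ℝ) = 0 ∧ (l : ℝ) = 0 := by norm_cast; omega
          simp [this]
        · have h' : (n : ℝ) + l = k + 1 := by exact_mod_cast h
          rw [coeff_X_mul, coeff_derivative, h']; ring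
      rw [this]
      rcases n with _ | n
      · simp
      · have : (legendre l).coeff (n + 1 + l) = 0 :=
          coeff_eq_zero_of_natDegree_lt (by have := natDegree_legendre_le l; omega)
        simp [this])
  have e1 : ∀ x : S2, (legendre l * (X * derivative (legendre l) - C (l : ℝ) * legendre l)).eval
      (x.1 2) = (legendre l * (X * derivative (legendre l))).eval (x.1 2) -
        l * (legendre l * legendre l).eval (x.1 2) := by
    intro x; simp; ring
  have e2 : ∀ x : S2, (derivative (X * (legendre l * legendre l))).eval (x.1 2) =
      (legendre l * legendre l).eval (x.1 2) +
        2 * (legendre l * (X * derivative (legendre l))).eval (x.1 2) := by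
    intro x; simp [derivative_mul]; ring
  simp only [e1] at hq
  simp only [e2] at h
  rw [integral_sub (integrable_of_continuous (by fun_prop))
    (integrable_of_continuous (by fun_prop)), integral_const_mul] at hq
  rw [integral_add (integrable_of_continuous (by fun_prop))
    (integrable_of_continuous (by fun_prop)), integral_const_mul] at h
  simp only [eval_mul, eval_X, legendre_eval_one, legendre_eval_neg_one] at h hq ⊢
  have h4 : ((-1 : ℝ) ^ l * (-1) ^ l) = 1 := by rw [← mul_pow]; simp
  rw [h4] at h
  rw [eq_div_iff (by positivity)]
  linear_combination h - 2 * hq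

open Polynomial in
/-- The product of two associated Legendre functions of the same order `m`, a polynomial since the
factors `(1 - z²)^{m/2}` combine. -/
def assocProd (l l' m : ℕ) : ℝ[X] :=
  (1 - X ^ 2) ^ m * derivative^[m] (legendre l) * derivative^[m] (legendre l')

open Polynomial in
theorem integral_assocProd_succ (l l' m : ℕ) :
    ∫ x, (assocProd l l' (m + 1)).eval (x.1 2) ∂surface =
      ((l : ℝ) - m) * (l + m + 1) * ∫ x, (assocProd l l' m).eval (x.1 2) ∂surface := by
  have h := integral_derivative_mul ((1 - X ^ 2) ^ (m + 1) * derivative^[m + 1] (legendre l))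
    (derivative^[m] (legendre l')) (by simp) (by simp)
  rw [derivative_legendre_weight, ← Function.iterate_succ_apply' derivative] at h
  have e : ∀ x : S2, ((-C (((l : ℝ) - m) * (l + m + 1)) * ((1 - X ^ 2) ^ m *
      derivative^[m] (legendre l)) * derivative^[m] (legendre l')).eval (x.1 2)) =
      -(((l : ℝ) - m) * (l + m + 1) * (assocProd l l' m).eval (x.1 2)) := by
    intro x; simp [assocProd]; ring
  simp only [e] at h
  rw [integral_neg, integral_const_mul] at h
  exact (neg_injective h).symm

open Polynomial in
/-- Both ways of applying the recursion in `m` at order `0` agree, and the eigenvalues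
`l (l + 1)` and `l' (l' + 1)` differ. -/
theorem integral_assocProd_of_ne {l l' : ℕ} (hl : l ≠ l') (m : ℕ) :
    ∫ x, (assocProd l l' m).eval (x.1 2) ∂surface = 0 := by
  have hcomm : ∀ k, assocProd l l' k = assocProd l' l k := by
    intro k; simp only [assocProd]; ring
  induction m with
  | zero =>
    have h1 := integral_assocProd_succ l l' 0
    have h2 := integral_assocProd_succ l' l 0
    rw [← hcomm, ← hcomm, h1] at h2
    have h3 : (((l : ℝ) - l') * (l + l' + 1)) *
        ∫ x, (assocProd l l' 0).eval (x.1 2) ∂surface = 0 := by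
      push_cast at h2
      linear_combination h2
    have h4 : (l : ℝ) - l' ≠ 0 := sub_ne_zero.2 (by exact_mod_cast hl)
    have h5 : (l : ℝ) + l' + 1 ≠ 0 := by positivity
    exact (mul_eq_zero.1 h3).resolve_left (mul_ne_zero h4 h5)
  | succ m ih => rw [integral_assocProd_succ, ih, mul_zero]

theorem integral_assocProd_self (l m : ℕ) (hm : m ≤ l) :
    ((2 * l + 1) * ((l - m).factorial : ℝ)) * ∫ x, (assocProd l l m).eval (x.1 2) ∂surface =
      4 * Real.pi * ((l + m).factorial : ℝ) := by
  induction m with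
  | zero =>
    have h := integral_legendre_sq l
    simp only [assocProd, pow_zero, one_mul, Function.iterate_zero, id] at h ⊢
    rw [h]
    simp
    field_simp
  | succ m ih =>
    have h := ih (by omega)
    rw [integral_assocProd_succ]
    have h1 : (l - m).factorial = (l - m) * (l - (m + 1)).factorial := by
      rw [← Nat.mul_factorial_pred (by omega : l - m ≠ 0)]; rfl
    have h2 : (l + (m + 1)).factorial = (l + m + 1) * (l + m).factorial := Nat.factorial_succ _
    rw [h1] at h
    rw [h2]
    push_cast [Nat.cast_sub (show m ≤ l by omega)] at h ⊢
    linear_combination (l + m + 1 : ℝ) * h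

/-- The complex coordinate `x₀ + i x₁`. -/
def zeta (x : S2) : ℂ := (x.1 0 : ℂ) + Complex.I * (x.1 1 : ℂ)

theorem continuous_zeta : Continuous zeta := by unfold zeta; fun_prop

theorem zeta_mul_conj (x : S2) :
    zeta x * (starRingEnd ℂ) (zeta x) = ((1 - x.1 2 ^ 2 : ℝ) : ℂ) := by
  have h : (1 : ℝ) - x.1 2 ^ 2 = x.1 0 ^ 2 + x.1 1 ^ 2 := by linarith [sum_sq_coord x]
  rw [h, zeta]
  simp
  linear_combination -(x.1 1 : ℂ) ^ 2 * Complex.I_sq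

theorem zeta_rotZ (θ : ℝ) (x : S2) :
    zeta (rotate (rotZ θ) x) = Complex.exp (Complex.I * θ) * zeta x := by
  rw [zeta, rotZ_zero, rotZ_one, zeta, mul_comm Complex.I (θ : ℂ), Complex.exp_mul_I]
  push_cast
  linear_combination -(Complex.sin θ * x.1 1) * Complex.I_sq

/-- The part of `Y_{lm}` (`m ≥ 0`) depending on the third coordinate only. -/
def zPart (l m : ℕ) : Polynomial ℝ :=
  Polynomial.C (harmonicConst l m * (-1) ^ m) * Polynomial.derivative^[m] (legendre l)

theorem harmonic_natCast (l m : ℕ) (x : S2) :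
    harmonic l m x = (((zPart l m).eval (x.1 2) : ℝ) : ℂ) * zeta x ^ m := by
  simp [harmonic, harmonicNonneg, zPart, zeta, mul_assoc]

theorem conj_harmonic (l : ℕ) (m : ℤ) (x : S2) :
    (starRingEnd ℂ) (harmonic l m x) = (-1) ^ m.natAbs * harmonic l (-m) x := by
  obtain ⟨k, rfl | rfl⟩ := m.eq_nat_or_neg
  · rcases k with _ | k
    · have := harmonic_natCast l 0 x
      simp only [Nat.cast_zero] at this
      simp [this]
    · have h : ¬ (0 : ℤ) ≤ -((k + 1 : ℕ) : ℤ) := by omega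
      rw [harmonic_natCast]
      rw [harmonic, if_neg h]
      have := harmonic_natCast l (k + 1) x
      simp only [harmonic, if_pos (Int.natCast_nonneg (k + 1)), Int.toNat_natCast] at this
      rw [Int.natAbs_neg, Int.natAbs_natCast, this, ← mul_assoc, ← mul_pow]
      simp
  · rcases k with _ | k
    · have := harmonic_natCast l 0 x
      simp only [Nat.cast_zero] at this
      simp [this]
    · have h : ¬ (0 : ℤ) ≤ -((k + 1 : ℕ) : ℤ) := by omega
      rw [neg_neg, harmonic_natCast]
      rw [harmonic, if_neg h]
      have := harmonic_natCast l (k + 1) x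
      simp only [harmonic, if_pos (Int.natCast_nonneg (k + 1)), Int.toNat_natCast] at this
      rw [Int.natAbs_neg, Int.natAbs_natCast, this]
      simp

theorem harmonic_neg (l : ℕ) (m : ℤ) (x : S2) :
    harmonic l (-m) x = (-1) ^ m.natAbs * (starRingEnd ℂ) (harmonic l m x) := by
  rw [conj_harmonic, ← mul_assoc, ← mul_pow]
  simp

theorem continuous_harmonic (l : ℕ) (m : ℤ) : Continuous (harmonic l m) := by
  have key : ∀ k : ℕ, Continuous (harmonic l k) := by
    intro k
    have : harmonic l k = fun x => (((zPart l k).eval (x.1 2) : ℝ) : ℂ) * zeta x ^ k :=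
      funext (harmonic_natCast l k)
    rw [this]
    have := continuous_zeta
    fun_prop
  obtain ⟨k, rfl | rfl⟩ := m.eq_nat_or_neg
  · exact key k
  · have : harmonic l (-k) = fun x => (-1) ^ (k : ℤ).natAbs * (starRingEnd ℂ) (harmonic l k x) :=
      funext (harmonic_neg l k)
    rw [this]
    exact continuous_const.mul (Complex.continuous_conj.comp (key k))

theorem harmonic_rotZ (l : ℕ) (m : ℤ) (θ : ℝ) (x : S2) :
    harmonic l m (rotate (rotZ θ) x) = Complex.exp (Complex.I * θ * m) * harmonic l m x := by
  have key : ∀ k : ℕ, harmonic l k (rotate (rotZ θ) x) =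
      Complex.exp (Complex.I * θ * k) * harmonic l k x := by
    intro k
    rw [harmonic_natCast, harmonic_natCast, zeta_rotZ, rotZ_two, mul_pow, ← Complex.exp_nat_mul]
    ring_nf
  obtain ⟨k, rfl | rfl⟩ := m.eq_nat_or_neg
  · simpa using key k
  · rw [harmonic_neg, harmonic_neg, key k, map_mul, ← Complex.exp_conj]
    simp
    ring

theorem integral_harmonic_mul_conj_of_ne (l l' : ℕ) {m m' : ℤ} (h : m ≠ m') :
    ∫ x, harmonic l m x * (starRingEnd ℂ) (harmonic l' m' x) ∂surface = 0 := by
  have hd : ((m : ℝ) - m') ≠ 0 := sub_ne_zero.2 (by exact_mod_cast h)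
  -- Rotating by this angle multiplies the integrand by `-1`.
  set θ : ℝ := Real.pi / (m - m') with hθ
  have hI := integral_rotate (rotZ θ)
    (fun x => harmonic l m x * (starRingEnd ℂ) (harmonic l' m' x))
  have he : Complex.exp (Complex.I * θ * m) *
      (starRingEnd ℂ) (Complex.exp (Complex.I * θ * m')) = -1 := by
    rw [← Complex.exp_conj, ← Complex.exp_add, ← Complex.exp_pi_mul_I]
    congr 1
    have : (Real.pi : ℂ) = θ * (m - m') := by
      rw [hθ]
      have hd' : ((m : ℂ) - m') ≠ 0 := by exact_mod_cast hd
      push_cast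
      field_simp
    rw [this]
    simp
    ring
  have hneg : ∀ x, harmonic l m (rotate (rotZ θ) x) *
      (starRingEnd ℂ) (harmonic l' m' (rotate (rotZ θ) x)) =
      -(harmonic l m x * (starRingEnd ℂ) (harmonic l' m' x)) := by
    intro x
    rw [harmonic_rotZ, harmonic_rotZ, map_mul]
    linear_combination (harmonic l m x * (starRingEnd ℂ) (harmonic l' m' x)) * he
  simp only [hneg, integral_neg] at hI
  exact self_eq_neg.1 hI.symm

theorem integral_harmonic_natCast (l l' m : ℕ) (hm : m ≤ l) :
    ∫ x, harmonic l m x * (starRingEnd ℂ) (harmonic l' m x) ∂surface =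
      if l = l' then 1 else 0 := by
  have e : ∀ x, harmonic l m x * (starRingEnd ℂ) (harmonic l' m x) =
      ((harmonicConst l m * harmonicConst l' m * (assocProd l l' m).eval (x.1 2) : ℝ) : ℂ) := by
    intro x
    rw [harmonic_natCast, harmonic_natCast, map_mul, map_pow, Complex.conj_ofReal,
      mul_mul_mul_comm, ← mul_pow, zeta_mul_conj]
    have h1 : ((-1 : ℂ) ^ m) * (-1) ^ m = 1 := by rw [← mul_pow]; simp
    simp [zPart, assocProd]
    linear_combination (harmonicConst l m * harmonicConst l' m *
      (Polynomial.eval (x.1 2) (Polynomial.derivative^[m] (legendre l))) *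
      (Polynomial.eval (x.1 2) (Polynomial.derivative^[m] (legendre l'))) *
      (1 - (x.1 2 : ℂ) ^ 2) ^ m : ℂ) * h1
  simp only [e]
  rw [integral_complex_ofReal, integral_const_mul]
  split_ifs with h
  · subst h
    have h2 := integral_assocProd_self l m hm
    have h3 := Nat.factorial_ne_zero (l - m)
    have h4 := Nat.factorial_ne_zero (l + m)
    have h5 := Real.pi_pos
    rw [harmonicConst, Real.mul_self_sqrt (by positivity)]
    have : (2 * (l : ℝ) + 1) / (4 * Real.pi) * (((l - m).factorial : ℝ) / ((l + m).factorial : ℝ)) *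
        ∫ x, (assocProd l l m).eval (x.1 2) ∂surface = 1 := by
      field_simp
      linear_combination h2
    rw [this]; simp
  · rw [integral_assocProd_of_ne h]; simp

/-- The spherical harmonics are orthonormal. -/
theorem integral_harmonic (l l' : ℕ) (m m' : ℤ) (hm : m.natAbs ≤ l) :
    ∫ x, harmonic l m x * (starRingEnd ℂ) (harmonic l' m' x) ∂surface =
      if l = l' ∧ m = m' then 1 else 0 := by
  by_cases h : m = m'
  · subst h
    simp only [and_true]
    obtain ⟨k, rfl | rfl⟩ := m.eq_nat_or_neg
    · exact integral_harmonic_natCast l l' k (by simpa using hm)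
    · have h1 := integral_harmonic_natCast l l' k (by simpa using hm)
      have h2 : ∀ x, harmonic l (-k) x * (starRingEnd ℂ) (harmonic l' (-k) x) =
          (starRingEnd ℂ) (harmonic l k x * (starRingEnd ℂ) (harmonic l' k x)) := by
        intro x
        rw [harmonic_neg, harmonic_neg, map_mul, map_mul, map_pow]
        have h1 : ((-1 : ℂ) ^ k) * (-1) ^ k = 1 := by rw [← mul_pow]; simp
        simp
        linear_combination ((starRingEnd ℂ) (harmonic l k x) * harmonic l' k x) * h1
      simp only [h2]
      rw [integral_conj, h1]
      split_ifs <;> simp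
  · rw [integral_harmonic_mul_conj_of_ne l l' h]
    simp [h]

theorem harmonic_pole (l : ℕ) (m : ℤ) :
    harmonic l m pole = if m = 0 then (Real.sqrt ((2 * l + 1) / (4 * Real.pi)) : ℂ) else 0 := by
  have key : ∀ k : ℕ, harmonic l k pole =
      if k = 0 then (Real.sqrt ((2 * l + 1) / (4 * Real.pi)) : ℂ) else 0 := by
    intro k
    have hz : zeta pole = 0 := by simp [zeta, pole]
    have h2 : pole.1 2 = 1 := by simp [pole]
    rw [harmonic_natCast, hz, h2]
    split_ifs with h
    · subst h
      have := Nat.factorial_ne_zero l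
      simp [zPart, legendre_eval_one, harmonicConst, this]
    · simp [h]
  obtain ⟨k, rfl | rfl⟩ := m.eq_nat_or_neg
  · simpa using key k
  · rw [harmonic_neg, key]
    rcases k with _ | k
    · simp
    · simp
      intro h; omega

/-! ### Rotation invariance of the zonal kernels -/

/-- The restrictions to the sphere of the complex-valued affine functions on `ℝ³`. The power
`affineFunctions ^ N`, a product of submodules of the algebra of functions, consists of the
restrictions of the polynomials of degree at most `N`. -/
def affineFunctions : Submodule ℂ (S2 → ℂ) :=
  Submodule.span ℂ (insert 1 (Set.range fun (i : Fin 3) (x : S2) => (x.1 i : ℂ)))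

theorem one_mem_affineFunctions : (1 : S2 → ℂ) ∈ affineFunctions :=
  Submodule.subset_span (Set.mem_insert _ _)

theorem coord_mem_affineFunctions (i : Fin 3) : (fun x : S2 => (x.1 i : ℂ)) ∈ affineFunctions :=
  Submodule.subset_span (Set.mem_insert_of_mem _ ⟨i, rfl⟩)

theorem zeta_mem_affineFunctions : zeta ∈ affineFunctions :=
  Submodule.add_mem _ (coord_mem_affineFunctions 0)
    (Submodule.smul_mem _ Complex.I (coord_mem_affineFunctions 1))

theorem conj_zeta_mem_affineFunctions : (fun x => (starRingEnd ℂ) (zeta x)) ∈ affineFunctions := by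
  have : (fun x => (starRingEnd ℂ) (zeta x)) =
      (fun x : S2 => (x.1 0 : ℂ)) + (-Complex.I) • fun x : S2 => (x.1 1 : ℂ) := by
    ext x; simp [zeta]
  rw [this]
  exact Submodule.add_mem _ (coord_mem_affineFunctions 0)
    (Submodule.smul_mem _ _ (coord_mem_affineFunctions 1))

theorem affineFunctions_pow_mono {m n : ℕ} (h : m ≤ n) :
    affineFunctions ^ m ≤ affineFunctions ^ n :=
  pow_le_pow_right' (Submodule.one_le.2 one_mem_affineFunctions) h

theorem eval_mem_affineFunctions_pow (p : Polynomial ℝ) (d : ℕ) (hp : p.natDegree ≤ d) :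
    (fun x : S2 => ((p.eval (x.1 2) : ℝ) : ℂ)) ∈ affineFunctions ^ d := by
  have : (fun x : S2 => ((p.eval (x.1 2) : ℝ) : ℂ)) =
      ∑ i ∈ Finset.range (p.natDegree + 1), (p.coeff i : ℂ) • (fun x : S2 => (x.1 2 : ℂ)) ^ i := by
    ext x
    rw [Polynomial.eval_eq_sum_range]
    simp
  rw [this]
  refine Submodule.sum_mem _ fun i hi => Submodule.smul_mem _ _ ?_
  refine affineFunctions_pow_mono (m := i) ?_ (Submodule.pow_mem_pow _
    (coord_mem_affineFunctions 2) i)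
  have := Finset.mem_range.1 hi
  omega

theorem natDegree_zPart_le (l m : ℕ) : (zPart l m).natDegree ≤ l - m :=
  (Polynomial.natDegree_C_mul_le _ _).trans <|
    (Polynomial.natDegree_iterate_derivative _ _).trans
      (Nat.sub_le_sub_right (natDegree_legendre_le l) m)

theorem harmonic_mem_affineFunctions_pow (l : ℕ) (m : ℤ) (hm : m.natAbs ≤ l) :
    harmonic l m ∈ affineFunctions ^ l := by
  obtain ⟨k, rfl | rfl⟩ := m.eq_nat_or_neg
  · have : harmonic l k = (fun x : S2 => (((zPart l k).eval (x.1 2) : ℝ) : ℂ)) * zeta ^ k :=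
      funext (harmonic_natCast l k)
    have hk : l - k + k = l := Nat.sub_add_cancel (by simpa using hm)
    have h := Submodule.mul_mem_mul (eval_mem_affineFunctions_pow _ _ (natDegree_zPart_le l k))
      (Submodule.pow_mem_pow _ zeta_mem_affineFunctions k)
    rwa [← this, ← pow_add, hk] at h
  · have : harmonic l (-k) = ((-1 : ℂ) ^ (k : ℤ).natAbs) •
        ((fun x : S2 => (((zPart l k).eval (x.1 2) : ℝ) : ℂ)) *
          (fun x => (starRingEnd ℂ) (zeta x)) ^ k) := by
      ext x
      rw [harmonic_neg, harmonic_natCast]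
      simp
    have hk : l - k + k = l := Nat.sub_add_cancel (by simpa using hm)
    have h := Submodule.mul_mem_mul (eval_mem_affineFunctions_pow _ _ (natDegree_zPart_le l k))
      (Submodule.pow_mem_pow _ conj_zeta_mem_affineFunctions k)
    rw [← pow_add, hk] at h
    rw [this]
    exact Submodule.smul_mem _ _ h

/-- Composition with a rotation, as an algebra homomorphism. -/
def compRotate (g : SO3) : (S2 → ℂ) →ₐ[ℂ] (S2 → ℂ) where
  toFun f x := f (rotate g x)
  map_one' := rfl
  map_mul' _ _ := rfl
  map_zero' := rfl
  map_add' _ _ := rfl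
  commutes' _ := rfl

theorem comp_rotate_mem_affineFunctions_pow (g : SO3) (n : ℕ) {f : S2 → ℂ}
    (hf : f ∈ affineFunctions ^ n) : (fun x => f (rotate g x)) ∈ affineFunctions ^ n := by
  have hle : affineFunctions.map (compRotate g).toLinearMap ≤ affineFunctions := by
    rw [affineFunctions, Submodule.map_span_le]
    rintro f (rfl | ⟨i, rfl⟩)
    · exact one_mem_affineFunctions
    · have : (compRotate g).toLinearMap (fun x : S2 => (x.1 i : ℂ)) =
          ∑ j, ((g : Matrix (Fin 3) (Fin 3) ℝ) i j : ℂ) • fun x : S2 => (x.1 j : ℂ) := by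
        ext x
        change (((rotate g x).1 i : ℝ) : ℂ) = _
        rw [rotate_apply]
        simp
      rw [this]
      exact Submodule.sum_mem _ fun j _ => Submodule.smul_mem _ _ (coord_mem_affineFunctions j)
  have h := Submodule.mem_map_of_mem (f := (compRotate g).toLinearMap) hf
  rw [Submodule.map_pow] at h
  exact pow_le_pow_left' hle n h

/-- The index set of the spherical harmonics of degree at most `N`. -/
def harmonicIndex (N : ℕ) : Finset (Σ _ : ℕ, ℤ) :=
  (Finset.range (N + 1)).sigma fun l => Finset.Icc (-(l : ℤ)) l

theorem mem_harmonicIndex {N : ℕ} {p : Σ _ : ℕ, ℤ} :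
    p ∈ harmonicIndex N ↔ p.1 ≤ N ∧ p.2.natAbs ≤ p.1 := by
  rw [harmonicIndex, Finset.mem_sigma, Finset.mem_range, Finset.mem_Icc]
  omega

/-- The span of the spherical harmonics of degree at most `N`. -/
def harmonicSpan (N : ℕ) : Submodule ℂ (S2 → ℂ) :=
  Submodule.span ℂ (Set.range fun p : harmonicIndex N => harmonic p.1.1 p.1.2)

theorem harmonic_mem_harmonicSpan {N l : ℕ} {m : ℤ} (hl : l ≤ N) (hm : m.natAbs ≤ l) :
    harmonic l m ∈ harmonicSpan N :=
  Submodule.subset_span ⟨⟨⟨l, m⟩, mem_harmonicIndex.2 ⟨hl, hm⟩⟩, rfl⟩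

theorem conj_mem_harmonicSpan {N : ℕ} {f : S2 → ℂ} (hf : f ∈ harmonicSpan N) :
    (fun x => (starRingEnd ℂ) (f x)) ∈ harmonicSpan N := by
  induction hf using Submodule.span_induction with
  | mem f hf =>
    obtain ⟨⟨⟨l, m⟩, hp⟩, rfl⟩ := hf
    have hp := mem_harmonicIndex.1 hp
    have : (fun x => (starRingEnd ℂ) (harmonic l m x)) =
        ((-1 : ℂ) ^ m.natAbs) • harmonic l (-m) := funext (conj_harmonic l m)
    simp only [this]
    exact Submodule.smul_mem _ _ (harmonic_mem_harmonicSpan hp.1 (by simpa using hp.2))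
  | zero => simp; exact Submodule.zero_mem _
  | add f g _ _ hf hg =>
    simp only [Pi.add_apply, map_add]
    exact Submodule.add_mem _ hf hg
  | smul a f _ hf =>
    simp only [Pi.smul_apply, smul_eq_mul, map_mul]
    exact Submodule.smul_mem _ _ hf

/-- Subtracting a multiple of `Y_{m+k,m} = q(z) ζ^m`, where `q` has exact degree `k`, lowers
the degree of the polynomial factor. -/
theorem eval_mul_zeta_pow_mem_harmonicSpan (N m k : ℕ) (hk : m + k ≤ N + 1) (p : Polynomial ℝ)
    (hp : ∀ n, k ≤ n → p.coeff n = 0) :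
    (fun x : S2 => ((p.eval (x.1 2) : ℝ) : ℂ) * zeta x ^ m) ∈ harmonicSpan N := by
  induction k generalizing p with
  | zero =>
    have : p = 0 := by ext n; simp [hp n (Nat.zero_le _)]
    subst this
    simp
    exact Submodule.zero_mem _
  | succ k ih =>
    set q := zPart (m + k) m with hq
    have hqk : q.coeff k ≠ 0 := by
      rw [hq, zPart, Polynomial.coeff_C_mul, Polynomial.coeff_iterate_derivative, add_comm k m]
      have h1 : (m + k).descFactorial m ≠ 0 := by
        rw [Ne, Nat.descFactorial_eq_zero_iff_lt]; omega
      have h2 : harmonicConst (m + k) m ≠ 0 := by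
        have := Nat.factorial_pos (m + k - m)
        have := Nat.factorial_pos (m + k + m)
        have := Real.pi_pos
        exact (Real.sqrt_pos.2 (by positivity)).ne'
      rw [nsmul_eq_mul]
      have := coeff_legendre_ne_zero (m + k)
      have h3 : ((m + k).descFactorial m : ℝ) ≠ 0 := by exact_mod_cast h1
      positivity
    have hqn : ∀ n, k + 1 ≤ n → q.coeff n = 0 := fun n hn =>
      Polynomial.coeff_eq_zero_of_natDegree_lt (by
        have := natDegree_zPart_le (m + k) m
        rw [← hq] at this
        omega)
    have h1 := ih (by omega) (p - Polynomial.C (p.coeff k / q.coeff k) * q) (by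
      intro n hn
      rw [Polynomial.coeff_sub, Polynomial.coeff_C_mul]
      rcases hn.eq_or_lt with rfl | hn
      · field_simp; ring
      · rw [hp n hn, hqn n hn]; ring)
    have h2 := Submodule.smul_mem _ ((p.coeff k / q.coeff k : ℝ) : ℂ)
      (harmonic_mem_harmonicSpan (N := N) (l := m + k) (m := m) (by omega) (by simp))
    convert! Submodule.add_mem _ h1 h2 using 1
    ext x
    rw [Pi.add_apply, Pi.smul_apply, harmonic_natCast]
    simp
    ring

/-- The monomials `ζ^m z^k` and their conjugates, of degree at most `N`. -/
def monomials (N : ℕ) : Set (S2 → ℂ) :=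
  {f | ∃ m k, m + k ≤ N ∧ (f = (fun x => (x.1 2 : ℂ) ^ k * zeta x ^ m) ∨
    f = fun x => (x.1 2 : ℂ) ^ k * (starRingEnd ℂ) (zeta x) ^ m)}

theorem monomials_subset_harmonicSpan (N : ℕ) : monomials N ⊆ harmonicSpan N := by
  have key : ∀ m k, m + k ≤ N → (fun x : S2 => (x.1 2 : ℂ) ^ k * zeta x ^ m) ∈ harmonicSpan N := by
    intro m k h
    have := eval_mul_zeta_pow_mem_harmonicSpan N m (k + 1) (by omega) (Polynomial.X ^ k) (by
      intro n hn
      rw [Polynomial.coeff_X_pow, if_neg (by omega)])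
    simpa using this
  rintro f ⟨m, k, h, rfl | rfl⟩
  · exact key m k h
  · simpa using conj_mem_harmonicSpan (key m k h)

theorem affineFunctions_pow_le_span_monomials (N : ℕ) :
    affineFunctions ^ N ≤ Submodule.span ℂ (monomials N) := by
  have hA : affineFunctions ≤ Submodule.span ℂ {1, zeta, (fun x => (starRingEnd ℂ) (zeta x)),
      fun x => (x.1 2 : ℂ)} := by
    set S : Set (S2 → ℂ) := {1, zeta, (fun x => (starRingEnd ℂ) (zeta x)), fun x => (x.1 2 : ℂ)}
    have h1 : (1 : S2 → ℂ) ∈ Submodule.span ℂ S := Submodule.subset_span (by simp [S])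
    have h2 : zeta ∈ Submodule.span ℂ S := Submodule.subset_span (by simp [S])
    have h3 : (fun x => (starRingEnd ℂ) (zeta x)) ∈ Submodule.span ℂ S :=
      Submodule.subset_span (by simp [S])
    have h4 : (fun x : S2 => (x.1 2 : ℂ)) ∈ Submodule.span ℂ S :=
      Submodule.subset_span (by simp [S])
    rw [affineFunctions, Submodule.span_le]
    rintro f (rfl | ⟨i, rfl⟩)
    · exact h1
    · fin_cases i
      · convert! Submodule.smul_mem _ (1 / 2 : ℂ) (Submodule.add_mem _ h2 h3) using 1
        ext x; simp [zeta]; ring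
      · convert! Submodule.smul_mem _ (-Complex.I / 2 : ℂ) (Submodule.sub_mem _ h2 h3) using 1
        ext x; simp [zeta]
        linear_combination (x.1 1 : ℂ) * Complex.I_sq
      · exact h4
  induction N with
  | zero =>
    rw [pow_zero, Submodule.one_le]
    exact Submodule.subset_span ⟨0, 0, le_rfl, Or.inl (by ext x; simp)⟩
  | succ N ih =>
    rw [pow_succ]
    refine (mul_le_mul' ih hA).trans ?_
    rw [Submodule.span_mul_span, Submodule.span_le]
    -- The products of conjugate factors are reduced by `ζ * conj ζ = 1 - z²`.
    have hmix : ∀ (m k : ℕ), m + 1 + k ≤ N →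
        ∀ f : S2 → ℂ, ((f = fun x => (x.1 2 : ℂ) ^ k * zeta x ^ m) ∨
          f = fun x => (x.1 2 : ℂ) ^ k * (starRingEnd ℂ) (zeta x) ^ m) →
        (fun x => f x * (zeta x * (starRingEnd ℂ) (zeta x))) ∈
          Submodule.span ℂ (monomials (N + 1)) := by
      intro m k h f hf
      have e : (fun x => f x * (zeta x * (starRingEnd ℂ) (zeta x))) =
          f - fun x => (x.1 2 : ℂ) ^ 2 * f x := by
        ext x
        rw [zeta_mul_conj]
        simp
        ring
      rw [e]
      refine Submodule.sub_mem _ (Submodule.subset_span ⟨m, k, by omega, hf⟩)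
        (Submodule.subset_span ⟨m, k + 2, by omega, ?_⟩)
      rcases hf with rfl | rfl
      · left; ext x; ring
      · right; ext x; ring
    rintro _ ⟨f, ⟨m, k, h, hf⟩, e, he, rfl⟩
    simp only [Set.mem_insert_iff, Set.mem_singleton_iff] at he
    rcases he with rfl | rfl | rfl | rfl
    · refine Submodule.subset_span ⟨m, k, by omega, ?_⟩
      simpa using hf
    · rcases hf with rfl | rfl
      · refine Submodule.subset_span ⟨m + 1, k, by omega, Or.inl ?_⟩
        ext x; simp; ring
      · rcases m with _ | m
        · refine Submodule.subset_span ⟨1, k, by omega, Or.inl ?_⟩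
          ext x; simp
        · convert! hmix m k h _ (Or.inr rfl) using 1
          ext x; simp; ring
    · rcases hf with rfl | rfl
      · rcases m with _ | m
        · refine Submodule.subset_span ⟨1, k, by omega, Or.inr ?_⟩
          ext x; simp
        · convert! hmix m k h _ (Or.inl rfl) using 1
          ext x; simp; ring
      · refine Submodule.subset_span ⟨m + 1, k, by omega, Or.inr ?_⟩
        ext x; simp; ring
    · refine Submodule.subset_span ⟨m, k + 1, by omega, ?_⟩
      rcases hf with rfl | rfl
      · left; ext x; simp; ring
      · right; ext x; simp; ring

/-- The spherical harmonics of degree at most `N` span the polynomials of degree at most `N`. The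
right-hand side makes no reference to coordinates, so this gives the rotation invariance of the
left-hand side. -/
theorem harmonicSpan_eq (N : ℕ) : harmonicSpan N = affineFunctions ^ N := by
  apply le_antisymm
  · rw [harmonicSpan, Submodule.span_le]
    rintro _ ⟨⟨p, hp⟩, rfl⟩
    have hp := mem_harmonicIndex.1 hp
    exact affineFunctions_pow_mono hp.1 (harmonic_mem_affineFunctions_pow _ _ hp.2)
  · exact (affineFunctions_pow_le_span_monomials N).trans
      (Submodule.span_le.2 (monomials_subset_harmonicSpan N))

/-- Two orthonormal families indexed by the same finite type, the second one in the span of the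
first one, have the same reproducing kernel. -/
theorem sum_mul_conj_eq_of_orthonormal {ι : Type*} [Fintype ι] [DecidableEq ι] (e f : ι → S2 → ℂ)
    (hcont : ∀ i, Continuous (e i))
    (he : ∀ i j, ∫ x, e i x * (starRingEnd ℂ) (e j x) ∂surface = if i = j then 1 else 0)
    (hf : ∀ i j, ∫ x, f i x * (starRingEnd ℂ) (f j x) ∂surface = if i = j then 1 else 0)
    (hspan : ∀ i, f i ∈ Submodule.span ℂ (Set.range e)) (x y : S2) :
    ∑ i, f i x * (starRingEnd ℂ) (f i y) = ∑ i, e i x * (starRingEnd ℂ) (e i y) := by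
  simp only [Submodule.mem_span_range_iff_exists_fun] at hspan
  choose U hU using hspan
  have hfx : ∀ i x, f i x = ∑ j, U i j * e j x := by
    intro i x; rw [← hU i]; simp
  have hUU : (Matrix.of U) * (Matrix.of U).conjTranspose = 1 := by
    ext i k
    rw [Matrix.one_apply, ← hf i k, Matrix.mul_apply]
    simp only [hfx, map_sum, map_mul, Finset.sum_mul_sum]
    rw [integral_finsetSum _ fun j _ => integrable_of_continuous (by
      have := hcont; fun_prop)]
    congr 1; ext j
    rw [integral_finsetSum _ fun j _ => integrable_of_continuous (by
      have := hcont; fun_prop)]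
    have : ∀ j', ∫ x, U i j * e j x * ((starRingEnd ℂ) (U k j') * (starRingEnd ℂ) (e j' x)) ∂surface
        = U i j * (starRingEnd ℂ) (U k j') * if j = j' then 1 else 0 := by
      intro j'
      rw [← he, ← integral_const_mul]
      congr 1; ext x; ring
    simp only [this]
    simp [Matrix.conjTranspose_apply]
  have hUU' := mul_eq_one_comm.1 hUU
  have hij : ∀ j k, ∑ i, U i j * (starRingEnd ℂ) (U i k) = if j = k then 1 else 0 := by
    intro j k
    have := congrFun (congrFun hUU' k) j
    rw [Matrix.mul_apply, Matrix.one_apply] at this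
    simp only [Matrix.conjTranspose_apply, Matrix.of_apply] at this
    rw [show (if j = k then (1 : ℂ) else 0) = if k = j then 1 else 0 by simp only [eq_comm], ← this]
    exact Finset.sum_congr rfl fun i _ => mul_comm _ _
  simp only [hfx, map_sum, map_mul, Finset.sum_mul_sum]
  rw [Finset.sum_comm]
  refine Finset.sum_congr rfl fun j _ => ?_
  rw [Finset.sum_comm]
  have : ∀ k, ∑ i, U i j * e j x * ((starRingEnd ℂ) (U i k) * (starRingEnd ℂ) (e k y)) =
      (if j = k then 1 else 0) * (e j x * (starRingEnd ℂ) (e k y)) := by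
    intro k
    rw [← hij, Finset.sum_mul]
    exact Finset.sum_congr rfl fun i _ => by ring
  simp [this]

/-- The zonal kernel `∑_m Y_{lm}(x) Y_{lm}(y)^*` of degree `l`. -/
def zonalC (l : ℕ) (x y : S2) : ℂ :=
  ∑ m ∈ Finset.Icc (-(l : ℤ)) l, harmonic l m x * (starRingEnd ℂ) (harmonic l m y)

theorem sum_zonalC_rotate (N : ℕ) (g : SO3) (x y : S2) :
    ∑ l ∈ Finset.range N, zonalC l (rotate g x) (rotate g y) =
      ∑ l ∈ Finset.range N, zonalC l x y := by
  rcases N with _ | N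
  · simp
  have h := sum_mul_conj_eq_of_orthonormal (ι := harmonicIndex N)
    (fun p => harmonic p.1.1 p.1.2) (fun p x => harmonic p.1.1 p.1.2 (rotate g x))
    (fun p => continuous_harmonic _ _)
    (fun p q => by
      rw [integral_harmonic _ _ _ _ (mem_harmonicIndex.1 p.2).2]
      exact if_congr (by rw [Subtype.ext_iff, Sigma.ext_iff, heq_eq_eq]) rfl rfl)
    (fun p q => by
      rw [integral_rotate g (fun x => harmonic p.1.1 p.1.2 x *
        (starRingEnd ℂ) (harmonic q.1.1 q.1.2 x)),
        integral_harmonic _ _ _ _ (mem_harmonicIndex.1 p.2).2]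
      exact if_congr (by rw [Subtype.ext_iff, Sigma.ext_iff, heq_eq_eq]) rfl rfl)
    (fun p => by
      change _ ∈ harmonicSpan N
      rw [harmonicSpan_eq]
      apply comp_rotate_mem_affineFunctions_pow
      rw [← harmonicSpan_eq]
      have hp := mem_harmonicIndex.1 p.2
      exact harmonic_mem_harmonicSpan hp.1 hp.2) x y
  rw [Finset.sum_coe_sort (harmonicIndex N)
      (fun p => harmonic p.1 p.2 (rotate g x) * (starRingEnd ℂ) (harmonic p.1 p.2 (rotate g y))),
    Finset.sum_coe_sort (harmonicIndex N)
      (fun p => harmonic p.1 p.2 x * (starRingEnd ℂ) (harmonic p.1 p.2 y)),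
    harmonicIndex, Finset.sum_sigma, Finset.sum_sigma] at h
  exact h

/-- The part of the addition theorem that matters here: the zonal kernel is rotation invariant. -/
theorem zonalC_rotate (l : ℕ) (g : SO3) (x y : S2) :
    zonalC l (rotate g x) (rotate g y) = zonalC l x y := by
  have h1 := sum_zonalC_rotate (l + 1) g x y
  rw [Finset.sum_range_succ, Finset.sum_range_succ, sum_zonalC_rotate l g x y] at h1
  exact add_left_cancel h1

theorem conj_zonalC (l : ℕ) (x y : S2) : (starRingEnd ℂ) (zonalC l x y) = zonalC l x y := by
  rw [zonalC, map_sum]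
  refine Finset.sum_nbij' (fun m => -m) (fun m => -m) ?_ ?_ ?_ ?_ ?_
  · intro m hm; rw [Finset.mem_Icc] at hm ⊢; omega
  · intro m hm; rw [Finset.mem_Icc] at hm ⊢; omega
  · simp
  · simp
  · intro m _
    rw [map_mul, harmonic_neg, harmonic_neg, map_mul, map_pow]
    have h1 : ((-1 : ℂ) ^ m.natAbs) * (-1) ^ m.natAbs = 1 := by rw [← mul_pow]; simp
    simp only [Complex.conj_conj, map_neg, map_one]
    linear_combination (-(starRingEnd ℂ) (harmonic l m x) * harmonic l m y) * h1

/-- The zonal kernel as a real function; its imaginary part vanishes by `conj_zonalC`. -/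
def zonal (l : ℕ) (x y : S2) : ℝ := (zonalC l x y).re

theorem ofReal_zonal (l : ℕ) (x y : S2) : (zonal l x y : ℂ) = zonalC l x y :=
  Complex.conj_eq_iff_re.1 (conj_zonalC l x y)

theorem zonal_rotate (l : ℕ) (g : SO3) (x y : S2) :
    zonal l (rotate g x) (rotate g y) = zonal l x y := by
  rw [zonal, zonalC_rotate, zonal]

theorem continuous_zonal (l : ℕ) (x : S2) : Continuous (zonal l x) := by
  unfold zonal zonalC
  have := continuous_harmonic l
  fun_prop

/-! ### Gaussian Hilbert spaces -/

section GaussianHilbertSpace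

variable {Ω ι : Type*} [MeasurableSpace Ω] {P : Measure Ω}

/-- The Gaussian Hilbert space of a family `X` of random variables: the closed linear span in `L²`
of its members. Only those classes enter that are represented by some `X i`, so that square
integrability of the family is not needed for the definition. -/
def gaussianSpan (P : Measure Ω) (X : ι → Ω → ℝ) : Submodule ℝ (Lp ℝ 2 P) :=
  (Submodule.span ℝ {Z : Lp ℝ 2 P | ∃ i, Z =ᵐ[P] X i}).topologicalClosure

theorem inner_eq_integral (Z W : Lp ℝ 2 P) : inner ℝ Z W = ∫ ω, Z ω * W ω ∂P := by
  rw [L2.inner_def]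
  congr 1
  ext ω
  simp [mul_comm]

theorem inner_toLp {f g : Ω → ℝ} (hf : MemLp f 2 P) (hg : MemLp g 2 P) :
    inner ℝ (hf.toLp f) (hg.toLp g) = ∫ ω, f ω * g ω ∂P := by
  rw [inner_eq_integral]
  refine integral_congr_ae ?_
  filter_upwards [hf.coeFn_toLp, hg.coeFn_toLp] with ω h1 h2
  rw [h1, h2]

theorem coeFn_sum {κ : Type*} (s : Finset κ) (f : κ → Lp ℝ 2 P) :
    (∑ k ∈ s, f k : Lp ℝ 2 P) =ᵐ[P] fun ω => ∑ k ∈ s, f k ω := by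
  classical
  induction s using Finset.induction_on with
  | empty =>
    filter_upwards [Lp.coeFn_zero ℝ 2 P] with ω h
    simpa using h
  | insert k s hk ih =>
    rw [Finset.sum_insert hk]
    filter_upwards [Lp.coeFn_add (f k) (∑ k ∈ s, f k), ih] with ω h1 h2
    rw [h1, Finset.sum_insert hk, Pi.add_apply, h2]

variable [IsProbabilityMeasure P]

theorem integral_abs_le_norm (Z : Lp ℝ 2 P) : ∫ ω, |Z ω| ∂P ≤ ‖Z‖ := by
  have h := eLpNorm_le_eLpNorm_of_exponent_le (μ := P) (p := 1) (q := 2) (by norm_num)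
    (Lp.aestronglyMeasurable Z)
  rw [Lp.norm_def]
  have h1 : ∫ ω, |Z ω| ∂P = (eLpNorm Z 1 P).toReal := by
    rw [eLpNorm_one_eq_lintegral_enorm,
      ← integral_norm_eq_lintegral_enorm (Lp.aestronglyMeasurable Z)]
    rfl
  rw [h1]
  exact ENNReal.toReal_mono (Lp.eLpNorm_ne_top Z) h

omit [IsProbabilityMeasure P] in
theorem charFun_map_eq_integral (Z : Lp ℝ 2 P) (t : ℝ) :
    charFun (P.map Z) t = ∫ ω, Complex.exp (Complex.I * ((t * Z ω : ℝ) : ℂ)) ∂P := by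
  rw [charFun_apply_real, integral_map (Lp.aestronglyMeasurable Z).aemeasurable (by fun_prop)]
  congr 1; ext ω; congr 1; push_cast; ring

theorem integrable_exp_I (Z : Lp ℝ 2 P) (t : ℝ) :
    Integrable (fun ω => Complex.exp (Complex.I * ((t * Z ω : ℝ) : ℂ))) P := by
  refine Integrable.of_bound (C := 1) ?_ (ae_of_all _ fun ω => ?_)
  · have := Lp.aestronglyMeasurable Z
    have h : Continuous fun u : ℝ => Complex.exp (Complex.I * ((t * u : ℝ) : ℂ)) := by fun_prop
    exact h.comp_aestronglyMeasurable this
  · rw [mul_comm, Complex.norm_exp_ofReal_mul_I]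

/-- Characteristic functions depend continuously on the random variable in `L²`. -/
theorem continuous_charFun_map (t : ℝ) :
    Continuous fun Z : Lp ℝ 2 P => charFun (P.map Z) t := by
  refine (LipschitzWith.of_dist_le_mul (K := ‖t‖₊) fun Z W => ?_).continuous
  rw [dist_eq_norm, dist_eq_norm, charFun_map_eq_integral, charFun_map_eq_integral,
    ← integral_sub (integrable_exp_I Z t) (integrable_exp_I W t), coe_nnnorm]
  refine (norm_integral_le_integral_norm _).trans ?_
  refine le_trans ?_ (mul_le_mul_of_nonneg_left (integral_abs_le_norm (Z - W)) (norm_nonneg t))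
  rw [← integral_const_mul]
  refine integral_mono_ae ((integrable_exp_I Z t).sub (integrable_exp_I W t)).norm
    (((Lp.memLp (Z - W)).integrable (by norm_num)).abs.const_mul _) ?_
  filter_upwards [Lp.coeFn_sub Z W] with ω hω
  have e : Complex.exp (Complex.I * ((t * Z ω : ℝ) : ℂ)) -
      Complex.exp (Complex.I * ((t * W ω : ℝ) : ℂ)) =
      Complex.exp (Complex.I * ((t * W ω : ℝ) : ℂ)) *
        (Complex.exp (Complex.I * ((t * (Z ω - W ω) : ℝ) : ℂ)) - 1) := by
    rw [mul_sub, ← Complex.exp_add]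
    congr 2
    · push_cast; ring
    · ring
  simp only [e, norm_mul]
  rw [mul_comm Complex.I, Complex.norm_exp_ofReal_mul_I, one_mul, hω, Pi.sub_apply]
  refine Real.norm_exp_I_mul_ofReal_sub_one_le.trans ?_
  rw [norm_mul, Real.norm_eq_abs (Z ω - W ω)]

theorem charFun_map_of_mem_gaussianSpan {X : ι → Ω → ℝ} (hX : IsGaussianProcess X P)
    (hmean : ∀ i, ∫ ω, X i ω ∂P = 0) {Z : Lp ℝ 2 P} (hZ : Z ∈ gaussianSpan P X) (t : ℝ) :
    charFun (P.map Z) t = Complex.exp (-(‖Z‖ ^ 2 * t ^ 2 / 2 : ℝ)) := by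
  have hclosed : IsClosed {Z : Lp ℝ 2 P |
      charFun (P.map Z) t = Complex.exp (-(‖Z‖ ^ 2 * t ^ 2 / 2 : ℝ))} :=
    isClosed_eq (continuous_charFun_map t) (by fun_prop)
  refine closure_minimal (fun Z hZ => ?_) hclosed hZ
  have hlin : HasGaussianLaw Z P ∧ ∫ ω, Z ω ∂P = 0 := by
    obtain ⟨c, hc⟩ : ∃ c : ι →₀ ℝ, Z =ᵐ[P] fun ω => ∑ i ∈ c.support, c i • X i ω := by
      induction hZ using Submodule.span_induction with
      | mem Z hZ =>
        obtain ⟨i, hi⟩ := hZ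
        refine ⟨Finsupp.single i 1, hi.trans (ae_of_all _ fun ω => ?_)⟩
        change _ = (Finsupp.single i (1 : ℝ)).sum fun i a => a • X i ω
        rw [Finsupp.sum_single_index] <;> simp
      | zero =>
        refine ⟨0, ?_⟩
        filter_upwards [Lp.coeFn_zero ℝ 2 P] with ω h
        rw [h]; simp
      | add Z W _ _ hZ hW =>
        obtain ⟨c, hc⟩ := hZ
        obtain ⟨d, hd⟩ := hW
        refine ⟨c + d, ?_⟩
        filter_upwards [Lp.coeFn_add Z W, hc, hd] with ω h h1 h2
        rw [h, Pi.add_apply, h1, h2]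
        classical
        exact (Finsupp.sum_add_index' (h := fun i a => a • X i ω) (by simp)
          (fun i a b => add_smul a b _)).symm
      | smul a Z _ hZ =>
        obtain ⟨c, hc⟩ := hZ
        refine ⟨a • c, ?_⟩
        filter_upwards [Lp.coeFn_smul a Z, hc] with ω h h1
        rw [h, Pi.smul_apply, h1]
        change a • (c.sum fun i b => b • X i ω) = (a • c).sum fun i b => b • X i ω
        rw [Finsupp.sum_smul_index (by simp), Finsupp.smul_sum]
        simp [mul_assoc]
    refine ⟨((hX.smul c).hasGaussianLaw_fun_sum (I := c.support)).congr hc.symm, ?_⟩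
    rw [integral_congr_ae hc, integral_finsetSum (f := fun i ω => c i • X i ω) _ fun i _ =>
      (hX.hasGaussianLaw_eval i).integrable.smul (c i)]
    refine Finset.sum_eq_zero fun i _ => ?_
    simp only [smul_eq_mul]
    rw [integral_const_mul, hmean, mul_zero]
  have hvar : Var[Z; P] = ‖Z‖ ^ 2 := by
    rw [variance_of_integral_eq_zero (Lp.aestronglyMeasurable Z).aemeasurable hlin.2,
      ← real_inner_self_eq_norm_sq, inner_eq_integral]
    simp only [sq]
  change charFun (P.map Z) t = _
  rw [hlin.1.map_eq_gaussianReal, hlin.2, hvar, charFun_gaussianReal]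
  congr 1
  rw [Real.coe_toNNReal _ (by positivity)]
  push_cast
  ring

/-- The members of the Gaussian Hilbert space are centered Gaussian variables. -/
theorem map_eq_gaussianReal_of_mem_gaussianSpan {X : ι → Ω → ℝ} (hX : IsGaussianProcess X P)
    (hmean : ∀ i, ∫ ω, X i ω ∂P = 0) {Z : Lp ℝ 2 P} (hZ : Z ∈ gaussianSpan P X) :
    P.map Z = gaussianReal 0 (‖Z‖₊ ^ 2) := by
  have : IsProbabilityMeasure (P.map Z) :=
    Measure.isProbabilityMeasure_map (Lp.aestronglyMeasurable Z).aemeasurable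
  refine Measure.ext_of_charFun (funext fun t => ?_)
  rw [charFun_map_of_mem_gaussianSpan hX hmean hZ, charFun_gaussianReal]
  congr 1
  push_cast
  simp

/-- The moments of the standard normal distribution. -/
def stdMoment (n : ℕ) : ℝ := ∫ u, u ^ n ∂gaussianReal 0 1

theorem stdMoment_nonneg (n : ℕ) : 0 ≤ stdMoment n := by
  rcases n.even_or_odd with h | h
  · exact integral_nonneg fun u => h.pow_nonneg u
  · have h1 : ∫ u, u ^ n ∂gaussianReal 0 1 = ∫ u, (-u) ^ n ∂gaussianReal 0 1 := by
      conv_lhs => rw [← neg_zero, ← gaussianReal_map_neg,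
        integral_map (by fun_prop) (by fun_prop)]
    simp only [h.neg_pow, integral_neg] at h1
    have : stdMoment n = 0 := self_eq_neg.1 h1
    exact this.ge

omit [IsProbabilityMeasure P] in
theorem memLp_of_map_eq_gaussianReal {Z : Ω → ℝ} (hZm : AEMeasurable Z P) {v : ℝ≥0}
    (hZ : P.map Z = gaussianReal 0 v) (p : ℝ≥0∞) (hp : p ≠ ∞) : MemLp Z p P := by
  have := memLp_id_gaussianReal' (μ := 0) (v := v) p hp
  rw [← hZ] at this
  exact this.comp_of_map hZm

theorem integral_pow_of_mem_gaussianSpan {X : ι → Ω → ℝ} (hX : IsGaussianProcess X P)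
    (hmean : ∀ i, ∫ ω, X i ω ∂P = 0) {Z : Lp ℝ 2 P} (hZ : Z ∈ gaussianSpan P X) (n : ℕ) :
    ∫ ω, Z ω ^ n ∂P = ‖Z‖ ^ n * stdMoment n := by
  have h1 : ∫ ω, Z ω ^ n ∂P = ∫ u, u ^ n ∂gaussianReal 0 (‖Z‖₊ ^ 2) := by
    rw [← map_eq_gaussianReal_of_mem_gaussianSpan hX hmean hZ,
      integral_map (Lp.aestronglyMeasurable Z).aemeasurable (by fun_prop)]
  have h2 := gaussianReal_map_const_mul (μ := 0) (v := 1) ‖Z‖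
  rw [mul_zero, mul_one] at h2
  have h3 : NNReal.mk (‖Z‖ ^ 2) (sq_nonneg _) = ‖Z‖₊ ^ 2 := rfl
  rw [h1, ← h3, ← h2, integral_map (by fun_prop) (by fun_prop), stdMoment, ← integral_const_mul]
  congr 1; ext u; ring

theorem memLp_of_mem_gaussianSpan {X : ι → Ω → ℝ} (hX : IsGaussianProcess X P)
    (hmean : ∀ i, ∫ ω, X i ω ∂P = 0) {Z : Lp ℝ 2 P} (hZ : Z ∈ gaussianSpan P X)
    (p : ℝ≥0∞) (hp : p ≠ ∞) : MemLp Z p P :=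
  memLp_of_map_eq_gaussianReal (Lp.aestronglyMeasurable Z).aemeasurable
    (map_eq_gaussianReal_of_mem_gaussianSpan hX hmean hZ) p hp

theorem integral_eq_zero_of_mem_gaussianSpan {X : ι → Ω → ℝ} (hX : IsGaussianProcess X P)
    (hmean : ∀ i, ∫ ω, X i ω ∂P = 0) {Z : Lp ℝ 2 P} (hZ : Z ∈ gaussianSpan P X) :
    ∫ ω, Z ω ∂P = 0 := by
  have h := integral_pow_of_mem_gaussianSpan hX hmean hZ 1
  have h1 : stdMoment 1 = 0 := by simp [stdMoment]
  simpa [h1] using h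

theorem integrable_prod_of_mem_gaussianSpan {X : ι → Ω → ℝ} (hX : IsGaussianProcess X P)
    (hmean : ∀ i, ∫ ω, X i ω ∂P = 0) {κ : Type*} [Fintype κ] {Z : κ → Lp ℝ 2 P}
    (hZ : ∀ k, Z k ∈ gaussianSpan P X) : Integrable (fun ω => ∏ k, Z k ω) P := by
  rcases isEmpty_or_nonempty κ with h | h
  · simp
  have hc : (Fintype.card κ : ℝ≥0∞) ≠ 0 := by simp
  have := MemLp.prod' (s := Finset.univ) (p := fun _ : κ => (Fintype.card κ : ℝ≥0∞))
    (fun k _ => memLp_of_mem_gaussianSpan hX hmean (hZ k) _ (ENNReal.natCast_ne_top _))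
  simp only [Finset.sum_const, Finset.card_univ, nsmul_eq_mul] at this
  rw [ENNReal.mul_inv_cancel hc (ENNReal.natCast_ne_top _), inv_one] at this
  exact memLp_one_iff_integrable.1 this

/-- Uncorrelated members of the Gaussian Hilbert space are independent. -/
theorem iIndepFun_of_mem_gaussianSpan {X : ι → Ω → ℝ} (hX : IsGaussianProcess X P)
    (hmean : ∀ i, ∫ ω, X i ω ∂P = 0) {κ : Type*} [Fintype κ] {Z : κ → Lp ℝ 2 P}
    (hZ : ∀ k, Z k ∈ gaussianSpan P X) (horth : ∀ j k, j ≠ k → inner ℝ (Z j) (Z k) = (0 : ℝ)) :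
    iIndepFun (fun k => (Z k : Ω → ℝ)) P := by
  classical
  have hmeas : ∀ k, AEMeasurable (Z k) P := fun k => (Lp.aestronglyMeasurable (Z k)).aemeasurable
  have hm : AEMeasurable (fun ω k => Z k ω) P := aemeasurable_pi_lambda _ hmeas
  have hgauss : HasGaussianLaw (fun ω k => Z k ω) P := by
    refine ⟨⟨fun L => ?_⟩⟩
    -- A linear functional of the vector is again a member of the Gaussian Hilbert space.
    set W : Lp ℝ 2 P := ∑ k, L (Pi.single k 1) • Z k with hW
    have hWmem : W ∈ gaussianSpan P X :=
      Submodule.sum_mem _ fun k _ => Submodule.smul_mem _ _ (hZ k)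
    have hLW : (fun ω => L fun k => Z k ω) =ᵐ[P] W := by
      have h1 : W =ᵐ[P] fun ω => ∑ k, (L (Pi.single k 1) • Z k : Lp ℝ 2 P) ω := by
        rw [hW]; exact coeFn_sum _ _
      have h2 : ∀ᵐ ω ∂P, ∀ k, (L (Pi.single k 1) • Z k : Lp ℝ 2 P) ω =
          L (Pi.single k 1) * Z k ω := ae_all_iff.2 fun k => by
        filter_upwards [Lp.coeFn_smul (L (Pi.single k 1)) (Z k)] with ω h
        rw [h]; rfl
      filter_upwards [h1, h2] with ω h1 h2
      rw [h1]
      simp only [h2]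
      have := congrArg L (pi_eq_sum_univ' (fun k => Z k ω))
      rw [this, map_sum]
      refine Finset.sum_congr rfl fun k _ => ?_
      rw [map_smul, smul_eq_mul, mul_comm]
    have hmap : (P.map fun ω k => Z k ω).map L = gaussianReal 0 (‖W‖₊ ^ 2) := by
      rw [AEMeasurable.map_map_of_aemeasurable (by fun_prop) hm,
        ← map_eq_gaussianReal_of_mem_gaussianSpan hX hmean hWmem]
      exact Measure.map_congr hLW
    have hint : (P.map fun ω k => Z k ω)[L] = 0 := by
      rw [integral_map hm (by fun_prop), integral_congr_ae hLW]
      exact integral_eq_zero_of_mem_gaussianSpan hX hmean hWmem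
    have hvar : Var[L; P.map fun ω k => Z k ω] = ‖W‖₊ ^ 2 := by
      have := variance_id_gaussianReal (μ := 0) (v := ‖W‖₊ ^ 2)
      rw [← hmap, variance_map (by fun_prop) (by fun_prop)] at this
      simpa using this
    rw [hmap, hint, hvar]
    congr 1
    ext; simp
  refine hgauss.iIndepFun_of_covariance_eq_zero fun j k hjk => ?_
  rw [covariance_eq_sub (Lp.memLp _) (Lp.memLp _),
    integral_eq_zero_of_mem_gaussianSpan hX hmean (hZ j),
    zero_mul, sub_zero, ← horth j k hjk, inner_eq_integral]
  rfl

/-- Mixed moments of pairwise uncorrelated members of the Gaussian Hilbert space are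
nonnegative. -/
theorem integral_prod_nonneg_of_mem_gaussianSpan {X : ι → Ω → ℝ} (hX : IsGaussianProcess X P)
    (hmean : ∀ i, ∫ ω, X i ω ∂P = 0) {Z : ℕ → Lp ℝ 2 P} (hZ : ∀ k, Z k ∈ gaussianSpan P X)
    (horth : ∀ j k, j ≠ k → inner ℝ (Z j) (Z k) = (0 : ℝ)) {n : ℕ} (l : Fin n → ℕ) :
    0 ≤ ∫ ω, ∏ j, Z (l j) ω ∂P := by
  set s := Finset.univ.image l
  have hind := iIndepFun_of_mem_gaussianSpan hX hmean (Z := fun k : s => Z k) (fun k => hZ k)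
    (fun j k hjk => horth j k fun h => hjk (Subtype.ext h))
  have e : ∀ ω, ∏ j, Z (l j) ω =
      ∏ k : s, (Z k ω) ^ (Finset.univ.filter fun j => l j = k).card := by
    intro ω
    rw [Finset.prod_comp (fun k => Z k ω) l, ← Finset.prod_coe_sort]
  simp only [e]
  rw [hind.integral_fun_prod_comp
    (f := fun (k : s) u => u ^ (Finset.univ.filter fun j => l j = k).card)
    (fun k => (Lp.aestronglyMeasurable _).aemeasurable) (fun k => by fun_prop)]
  refine Finset.prod_nonneg fun k _ => ?_
  rw [integral_pow_of_mem_gaussianSpan hX hmean (hZ k)]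
  exact mul_nonneg (by positivity) (stdMoment_nonneg _)

end GaussianHilbertSpace

/-! ### The weights -/

theorem bernstein_nonneg {b : ℝ} (hb : 0 ≤ b) {M : Measure ℝ} (hM : IsLevyMeasure M) {r : ℝ}
    (hr : 0 ≤ r) : 0 ≤ bernstein b M r := by
  refine add_nonneg (mul_nonneg hb hr) (integral_nonneg_of_ae ?_)
  have h : ∀ᵐ z ∂M, z ∉ Set.Iic (0 : ℝ) := measure_eq_zero_iff_ae_notMem.1 hM.support
  filter_upwards [h] with z hz
  have hz : 0 < z := not_le.1 hz
  have : Real.exp (-r * z) ≤ 1 := Real.exp_le_one_iff.2 (by nlinarith)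
  simpa using this

theorem inverseLaplace_mem_Icc {Ω' : Type*} [MeasurableSpace Ω'] (H : ℝ≥0 → Ω' → ℝ)
    (Q : Measure Ω') [IsProbabilityMeasure Q] (t : ℝ) {r : ℝ} (hr : 0 ≤ r) :
    inverseLaplace H Q t r ∈ Set.Icc 0 1 := by
  refine ⟨integral_nonneg fun ω => (Real.exp_pos _).le, ?_⟩
  have h : ∀ ω, Real.exp (-r * inverse H t ω) ≤ 1 := fun ω => Real.exp_le_one_iff.2 (by
    have : 0 ≤ inverse H t ω := NNReal.coe_nonneg _
    nlinarith)
  have h1 := norm_integral_le_of_norm_le_const (μ := Q) (C := 1)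
    (f := fun ω => Real.exp (-r * inverse H t ω))
    (ae_of_all _ fun ω => by rw [Real.norm_of_nonneg (Real.exp_pos _).le]; exact h ω)
  simp only [probReal_univ, mul_one] at h1
  exact (le_abs_self _).trans h1

/-! ### The components of an isotropic Gaussian field -/

section Field

variable {Ω : Type*} [MeasurableSpace Ω] {P : Measure Ω} {T : S2 → Ω → ℝ}

/-- The random variable `∫ T(y) f(y) dy`. -/
def fieldIntegral (T : S2 → Ω → ℝ) (f : S2 → ℝ) (ω : Ω) : ℝ := ∫ y, T y ω * f y ∂surface

theorem IsIsotropicGaussianField.memLp (hT : IsIsotropicGaussianField T P) (x : S2) :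
    MemLp (T x) 2 P :=
  (hT.gaussian.hasGaussianLaw_eval x).memLp_two

theorem IsIsotropicGaussianField.integral_sq (hT : IsIsotropicGaussianField T P) (x : S2) :
    ∫ ω, T x ω ^ 2 ∂P = ∫ ω, T pole ω ^ 2 ∂P := by
  obtain ⟨g, rfl⟩ := exists_rotate_pole x
  simpa only [sq] using hT.isotropic g pole pole

variable [IsProbabilityMeasure P]

theorem IsIsotropicGaussianField.integrable_sq_prod (hT : IsIsotropicGaussianField T P) :
    Integrable (fun p : S2 × Ω => T p.1 p.2 ^ 2) (surface.prod P) := by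
  rw [integrable_prod_iff (hT.measurable.pow_const 2).aestronglyMeasurable]
  refine ⟨ae_of_all _ fun x => (hT.memLp x).integrable_sq, ?_⟩
  have : (fun x => ∫ ω, ‖T x ω ^ 2‖ ∂P) = fun _ => ∫ ω, T pole ω ^ 2 ∂P := by
    ext x
    rw [← hT.integral_sq x]
    congr 1; ext ω
    exact Real.norm_of_nonneg (sq_nonneg _)
  simp only [this]
  exact integrable_const _

theorem IsIsotropicGaussianField.memLp_prod (hT : IsIsotropicGaussianField T P) :
    MemLp (fun p : S2 × Ω => T p.1 p.2) 2 (surface.prod P) :=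
  (memLp_two_iff_integrable_sq hT.measurable.aestronglyMeasurable).2 hT.integrable_sq_prod

theorem IsIsotropicGaussianField.ae_memLp (hT : IsIsotropicGaussianField T P) :
    ∀ᵐ ω ∂P, MemLp (fun x => T x ω) 2 surface := by
  filter_upwards [hT.integrable_sq_prod.prod_left_ae] with ω hω
  exact (memLp_two_iff_integrable_sq
    (hT.measurable.comp (measurable_id.prodMk measurable_const)).aestronglyMeasurable).2 hω

theorem memLp_of_continuous {E : Type*} [NormedAddCommGroup E] {f : S2 → E} (hf : Continuous f)
    (p : ℝ≥0∞) : MemLp f p surface := by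
  obtain ⟨C, hC⟩ := (isCompact_univ.image hf).isBounded.exists_norm_le
  exact MemLp.of_bound (integrable_of_continuous hf).aestronglyMeasurable C
    (ae_of_all _ fun x => hC _ ⟨x, trivial, rfl⟩)

theorem IsIsotropicGaussianField.memLp_mul_prod (hT : IsIsotropicGaussianField T P) {f : S2 → ℝ}
    (hf : Continuous f) : MemLp (fun p : S2 × Ω => T p.1 p.2 * f p.1) 2 (surface.prod P) := by
  have h1 : MemLp (fun p : S2 × Ω => f p.1) ∞ (surface.prod P) :=
    (memLp_of_continuous hf ∞).comp_fst P
  exact h1.mul' hT.memLp_prod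

/-- The Cauchy-Schwarz inequality on the sphere, of total mass `4π`. -/
theorem sq_integral_le {g : S2 → ℝ} (hg : MemLp g 2 surface) :
    (∫ y, g y ∂surface) ^ 2 ≤ 4 * Real.pi * ∫ y, g y ^ 2 ∂surface := by
  have hint : Integrable g surface := hg.integrable (by norm_num)
  set I := ∫ y, g y ∂surface with hI
  have h0 : 0 ≤ ∫ y, (4 * Real.pi * g y - I) ^ 2 ∂surface := integral_nonneg fun y => sq_nonneg _
  have e : ∀ y, (4 * Real.pi * g y - I) ^ 2 =
      ((4 * Real.pi) ^ 2 * g y ^ 2 - (2 * (4 * Real.pi) * I) * g y) + I ^ 2 := by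
    intro y; ring
  simp only [e] at h0
  have hi : Integrable (fun y => (4 * Real.pi) ^ 2 * g y ^ 2 - (2 * (4 * Real.pi) * I) * g y)
      surface := (hg.integrable_sq.const_mul _).sub (hint.const_mul _)
  rw [integral_add hi (integrable_const _),
    integral_sub (hg.integrable_sq.const_mul _) (hint.const_mul _), integral_const_mul,
    integral_const_mul, ← hI, integral_const, surface_real_univ, smul_eq_mul] at h0
  have hpi : (0 : ℝ) < 4 * Real.pi := by positivity
  refine le_of_mul_le_mul_left ?_ hpi
  linarith

theorem IsIsotropicGaussianField.memLp_fieldIntegral (hT : IsIsotropicGaussianField T P)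
    {f : S2 → ℝ} (hf : Continuous f) : MemLp (fieldIntegral T f) 2 P := by
  have hmeas : StronglyMeasurable (fieldIntegral T f) :=
    StronglyMeasurable.integral_prod_left' (f := fun p : S2 × Ω => T p.1 p.2 * f p.1)
      (hT.measurable.mul (hf.measurable.comp measurable_fst)).stronglyMeasurable
  rw [memLp_two_iff_integrable_sq hmeas.aestronglyMeasurable]
  have hint := (hT.memLp_mul_prod hf).integrable_sq
  refine (hint.integral_prod_right.const_mul (4 * Real.pi)).mono'
    (hmeas.pow 2).aestronglyMeasurable ?_
  filter_upwards [hT.ae_memLp] with ω hω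
  rw [Real.norm_of_nonneg (sq_nonneg _)]
  exact sq_integral_le ((memLp_of_continuous hf ∞).mul' hω)

/-- Fubini's theorem for products of `∫ T(y) f(y) dy` with a square integrable variable. -/
theorem IsIsotropicGaussianField.integral_mul_fieldIntegral (hT : IsIsotropicGaussianField T P)
    {f : S2 → ℝ} (hf : Continuous f) {V : Ω → ℝ} (hV : MemLp V 2 P) :
    ∫ ω, V ω * fieldIntegral T f ω ∂P = ∫ y, f y * ∫ ω, V ω * T y ω ∂P ∂surface := by
  have hint : Integrable (Function.uncurry fun y ω => V ω * (T y ω * f y)) (surface.prod P) :=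
    (hV.comp_snd surface).integrable_mul (hT.memLp_mul_prod hf)
  have h := integral_integral_swap hint
  simp only [integral_const_mul] at h
  rw [show (fun ω => V ω * fieldIntegral T f ω) = fun ω => V ω * ∫ y, T y ω * f y ∂surface from rfl,
    ← h]
  congr 1; ext y
  rw [← integral_const_mul]
  congr 1; ext ω; ring

/-- By Fubini, a variable orthogonal to all `T y` is orthogonal to `∫ T(y) f(y) dy`, which therefore
lies in the closed span of the field. -/
theorem IsIsotropicGaussianField.toLp_fieldIntegral_mem (hT : IsIsotropicGaussianField T P)
    {f : S2 → ℝ} (hf : Continuous f) :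
    (hT.memLp_fieldIntegral hf).toLp _ ∈ gaussianSpan P T := by
  rw [gaussianSpan, ← Submodule.orthogonal_orthogonal_eq_closure, Submodule.mem_orthogonal]
  intro V hV
  rw [Submodule.mem_orthogonal'] at hV
  have hV0 : ∀ y, ∫ ω, V ω * T y ω ∂P = 0 := by
    intro y
    have h := hV ((hT.memLp y).toLp _) (Submodule.subset_span ⟨y, (hT.memLp y).coeFn_toLp⟩)
    rw [inner_eq_integral] at h
    rw [← h]
    refine integral_congr_ae ?_
    filter_upwards [(hT.memLp y).coeFn_toLp] with ω h1
    rw [h1]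
  have e : ∫ ω, V ω * (hT.memLp_fieldIntegral hf).toLp _ ω ∂P =
      ∫ ω, V ω * fieldIntegral T f ω ∂P := by
    refine integral_congr_ae ?_
    filter_upwards [(hT.memLp_fieldIntegral hf).coeFn_toLp] with ω h1
    rw [h1]
  rw [inner_eq_integral, e, hT.integral_mul_fieldIntegral hf (Lp.memLp V)]
  simp [hV0]

theorem IsIsotropicGaussianField.integral_fieldIntegral_mul_rotate
    (hT : IsIsotropicGaussianField T P) {f h : S2 → ℝ} (hf : Continuous f) (hh : Continuous h)
    (g : SO3) :
    ∫ ω, fieldIntegral T (fun y => f (rotate g y)) ω *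
        fieldIntegral T (fun y => h (rotate g y)) ω ∂P =
      ∫ ω, fieldIntegral T f ω * fieldIntegral T h ω ∂P := by
  have key : ∀ {f h : S2 → ℝ}, Continuous f → Continuous h →
      ∫ ω, fieldIntegral T f ω * fieldIntegral T h ω ∂P =
        ∫ z, h z * ∫ y, f y * ∫ ω, T z ω * T y ω ∂P ∂surface ∂surface := by
    intro f h hf hh
    rw [hT.integral_mul_fieldIntegral hh (hT.memLp_fieldIntegral hf)]
    congr 1; ext z
    rw [← hT.integral_mul_fieldIntegral hf (hT.memLp z)]
    simp only [mul_comm]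
  have hg := continuous_rotate g
  rw [key hf hh, key (f := fun y => f (rotate g y)) (h := fun y => h (rotate g y))
    (by fun_prop) (by fun_prop),
    ← integral_rotate g (fun z => h z * ∫ y, f y * ∫ ω, T z ω * T y ω ∂P ∂surface)]
  congr 1; ext z
  congr 1
  rw [← integral_rotate g (fun y => f y * ∫ ω, T (rotate g z) ω * T y ω ∂P)]
  simp only [hT.isotropic]

/-- The component of degree `l` of the field at the point `x`. -/
def component (T : S2 → Ω → ℝ) (l : ℕ) (x : S2) : Ω → ℝ := fieldIntegral T (zonal l x)

theorem IsIsotropicGaussianField.integral_component_mul (hT : IsIsotropicGaussianField T P)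
    (l l' : ℕ) (x : S2) :
    ∫ ω, component T l x ω * component T l' x ω ∂P =
      ∫ ω, component T l pole ω * component T l' pole ω ∂P := by
  obtain ⟨g, rfl⟩ := exists_rotate_pole x
  have h := hT.integral_fieldIntegral_mul_rotate (continuous_zonal l (rotate g pole))
    (continuous_zonal l' (rotate g pole)) g
  simp only [zonal_rotate] at h
  exact h.symm

omit [MeasurableSpace Ω] in
theorem integral_ofReal_mul_eq_fieldIntegral (f : S2 → ℂ) (hf : Continuous f) (ω : Ω)
    (hω : MemLp (fun x => T x ω) 2 surface) :
    ∫ x, (T x ω : ℂ) * f x ∂surface =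
      (fieldIntegral T (fun x => (f x).re) ω : ℂ) +
        Complex.I * (fieldIntegral T (fun x => (f x).im) ω : ℂ) := by
  rw [fieldIntegral, fieldIntegral, ← integral_complex_ofReal, ← integral_complex_ofReal,
    ← integral_const_mul, ← integral_add]
  · congr 1; ext x
    conv_lhs => rw [← Complex.re_add_im (f x)]
    push_cast; ring
  · exact (hω.integrable_mul (memLp_of_continuous (by fun_prop : Continuous fun x => (f x).re)
      2)).ofReal
  · exact ((hω.integrable_mul (memLp_of_continuous (by fun_prop : Continuous fun x => (f x).im)
      2)).ofReal).const_mul _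

theorem IsIsotropicGaussianField.memLp_coeff (hT : IsIsotropicGaussianField T P) (l : ℕ) (m : ℤ) :
    MemLp (coeff T l m) 2 P := by
  have hc : Continuous fun x => (starRingEnd ℂ) (harmonic l m x) :=
    Complex.continuous_conj.comp (continuous_harmonic l m)
  have h1 := (hT.memLp_fieldIntegral (Complex.continuous_re.comp hc)).ofReal (K := ℂ)
  have h2 := (hT.memLp_fieldIntegral (Complex.continuous_im.comp hc)).ofReal (K := ℂ)
  refine (memLp_congr_ae ?_).2 (h1.add (h2.const_mul Complex.I))
  filter_upwards [hT.ae_memLp] with ω hω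
  exact integral_ofReal_mul_eq_fieldIntegral _ hc ω hω

omit [MeasurableSpace Ω] in
theorem ofReal_component (l : ℕ) (x : S2) (ω : Ω) (hω : MemLp (fun x => T x ω) 2 surface) :
    (component T l x ω : ℂ) =
      ∑ m ∈ Finset.Icc (-(l : ℤ)) l, coeff T l m ω * harmonic l m x := by
  have hω' : MemLp (fun x => (T x ω : ℂ)) 2 surface := hω.ofReal
  rw [component, fieldIntegral, ← integral_complex_ofReal]
  simp only [Complex.ofReal_mul, ofReal_zonal, zonalC, Finset.mul_sum]
  rw [integral_finsetSum]
  · refine Finset.sum_congr rfl fun m _ => ?_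
    rw [coeff, ← integral_mul_const]
    congr 1; ext y; ring
  · intro m _
    exact hω'.integrable_mul (memLp_of_continuous (continuous_const.mul
      (Complex.continuous_conj.comp (continuous_harmonic l m))) 2)

/-- Covariances of the components, computed by averaging over the sphere, which is harmless
since they do not depend on the point. -/
theorem IsIsotropicGaussianField.integral_component_eq (hT : IsIsotropicGaussianField T P)
    (l l' : ℕ) :
    ((4 * Real.pi * ∫ ω, component T l pole ω * component T l' pole ω ∂P : ℝ) : ℂ) =
      if l = l' then ∑ m ∈ Finset.Icc (-(l : ℤ)) l,
        ∫ ω, coeff T l m ω * (starRingEnd ℂ) (coeff T l m ω) ∂P else 0 := by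
  have hint : ∀ m m', Integrable (fun ω => coeff T l m ω * (starRingEnd ℂ) (coeff T l' m' ω)) P :=
    fun m m' => (hT.memLp_coeff l m).integrable_mul (hT.memLp_coeff l' m').star
  have h1 : ∀ x, ((∫ ω, component T l pole ω * component T l' pole ω ∂P : ℝ) : ℂ) =
      ∑ m ∈ Finset.Icc (-(l : ℤ)) l, ∑ m' ∈ Finset.Icc (-(l' : ℤ)) l',
        (∫ ω, coeff T l m ω * (starRingEnd ℂ) (coeff T l' m' ω) ∂P) *
          (harmonic l m x * (starRingEnd ℂ) (harmonic l' m' x)) := by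
    intro x
    rw [← hT.integral_component_mul l l' x, ← integral_complex_ofReal]
    have e : (fun ω => ((component T l x ω * component T l' x ω : ℝ) : ℂ)) =ᵐ[P] fun ω =>
        ∑ m ∈ Finset.Icc (-(l : ℤ)) l, ∑ m' ∈ Finset.Icc (-(l' : ℤ)) l',
          (coeff T l m ω * (starRingEnd ℂ) (coeff T l' m' ω)) *
          (harmonic l m x * (starRingEnd ℂ) (harmonic l' m' x)) := by
      filter_upwards [hT.ae_memLp] with ω hω
      rw [Complex.ofReal_mul, ofReal_component l x ω hω, ← Complex.conj_ofReal (component T l' x ω),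
        ofReal_component l' x ω hω, map_sum, Finset.sum_mul_sum]
      refine Finset.sum_congr rfl fun m _ => Finset.sum_congr rfl fun m' _ => ?_
      rw [map_mul]; ring
    rw [integral_congr_ae e, integral_finsetSum]
    · refine Finset.sum_congr rfl fun m _ => ?_
      rw [integral_finsetSum _ fun m' _ => (hint m m').mul_const _]
      refine Finset.sum_congr rfl fun m' _ => ?_
      rw [integral_mul_const]
    · exact fun m _ => integrable_finsetSum _ fun m' _ => (hint m m').mul_const _
  -- Averaging over the sphere brings in the orthogonality relations.
  have h2 : ((4 * Real.pi * ∫ ω, component T l pole ω * component T l' pole ω ∂P : ℝ) : ℂ) =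
      ∫ _ : S2, ((∫ ω, component T l pole ω * component T l' pole ω ∂P : ℝ) : ℂ) ∂surface := by
    rw [integral_const, surface_real_univ]; simp
  have hc := continuous_harmonic
  have hi : ∀ m m', Integrable (fun x => harmonic l m x * (starRingEnd ℂ) (harmonic l' m' x))
      surface := fun m m' => integrable_of_continuous (by fun_prop)
  rw [h2, integral_congr_ae (ae_of_all _ h1), integral_finsetSum]
  swap
  · exact fun m _ => integrable_finsetSum _ fun m' _ => (hi m m').const_mul _
  rw [Finset.sum_congr rfl fun m hm => show _ = if l = l' then
    ∫ ω, coeff T l m ω * (starRingEnd ℂ) (coeff T l m ω) ∂P else 0 from ?_]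
  · split_ifs <;> simp
  · rw [integral_finsetSum _ fun m' _ => (hi m m').const_mul _]
    have hm' : m.natAbs ≤ l := by rw [Finset.mem_Icc] at hm; omega
    simp only [integral_const_mul, integral_harmonic l l' m _ hm']
    split_ifs with h
    · subst h
      simp [Finset.mem_Icc.1 hm]
    · simp [h]

omit [MeasurableSpace Ω] in
/-- Bessel's inequality for the random Fourier coefficients. -/
theorem sum_norm_sq_coeff_le (N : ℕ) (ω : Ω) (hω : MemLp (fun x => T x ω) 2 surface) :
    ∑ l ∈ Finset.range (N + 1), ∑ m ∈ Finset.Icc (-(l : ℤ)) l, ‖coeff T l m ω‖ ^ 2 ≤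
      ∫ x, T x ω ^ 2 ∂surface := by
  have hω' : MemLp (fun x => (T x ω : ℂ)) 2 surface := hω.ofReal
  set e : harmonicIndex N → Lp ℂ 2 surface :=
    fun p => (memLp_of_continuous (continuous_harmonic p.1.1 p.1.2) 2).toLp _ with he
  have hin : ∀ {f h : S2 → ℂ} (hf : MemLp f 2 surface) (hh : MemLp h 2 surface),
      inner ℂ (hf.toLp f) (hh.toLp h) = ∫ x, h x * (starRingEnd ℂ) (f x) ∂surface := by
    intro f h hf hh
    rw [L2.inner_def]
    refine integral_congr_ae ?_
    filter_upwards [hf.coeFn_toLp, hh.coeFn_toLp] with x h1 h2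
    rw [h1, h2]; simp
  have hon : Orthonormal ℂ e := by
    rw [orthonormal_iff_ite]
    intro p q
    rw [hin, integral_harmonic _ _ _ _ (mem_harmonicIndex.1 q.2).2]
    exact if_congr (by rw [Subtype.ext_iff, Sigma.ext_iff, heq_eq_eq]; simp only [eq_comm]) rfl rfl
  have h := hon.sum_inner_products_le (hω'.toLp _) (s := Finset.univ)
  simp only [he, hin] at h
  rw [Finset.sum_coe_sort (harmonicIndex N)
    (fun p => ‖∫ x, (T x ω : ℂ) * (starRingEnd ℂ) (harmonic p.1 p.2 x) ∂surface‖ ^ 2),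
    harmonicIndex, Finset.sum_sigma] at h
  refine h.trans (le_of_eq ?_)
  rw [← inner_self_eq_norm_sq (𝕜 := ℂ), hin]
  have : ∀ x, (T x ω : ℂ) * (starRingEnd ℂ) (T x ω : ℂ) = ((T x ω ^ 2 : ℝ) : ℂ) := by
    intro x; simp [sq]
  simp only [this]
  rw [integral_complex_ofReal]
  simp

theorem IsIsotropicGaussianField.integral_component_of_ne (hT : IsIsotropicGaussianField T P)
    {l l' : ℕ} (h : l ≠ l') (x : S2) :
    ∫ ω, component T l x ω * component T l' x ω ∂P = 0 := by
  have h1 := hT.integral_component_eq l l'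
  rw [if_neg h] at h1
  rw [hT.integral_component_mul]
  have h2 : 4 * Real.pi * ∫ ω, component T l pole ω * component T l' pole ω ∂P = 0 := by
    exact_mod_cast h1
  exact (mul_eq_zero.1 h2).resolve_left (by positivity)

/-- The variance of the component of degree `l`. -/
def componentVariance (P : Measure Ω) (T : S2 → Ω → ℝ) (l : ℕ) : ℝ :=
  ∫ ω, component T l pole ω ^ 2 ∂P

omit [IsProbabilityMeasure P] in
theorem componentVariance_nonneg (l : ℕ) : 0 ≤ componentVariance P T l :=
  integral_nonneg fun _ => sq_nonneg _

theorem IsIsotropicGaussianField.componentVariance_eq (hT : IsIsotropicGaussianField T P) (l : ℕ) :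
    4 * Real.pi * componentVariance P T l =
      ∫ ω, ∑ m ∈ Finset.Icc (-(l : ℤ)) l, ‖coeff T l m ω‖ ^ 2 ∂P := by
  have h := hT.integral_component_eq l l
  rw [if_pos rfl] at h
  have e : ∀ m ω, coeff T l m ω * (starRingEnd ℂ) (coeff T l m ω) =
      ((‖coeff T l m ω‖ ^ 2 : ℝ) : ℂ) := by
    intro m ω; rw [Complex.mul_conj, Complex.normSq_eq_norm_sq]
  simp only [e, integral_complex_ofReal] at h
  rw [integral_finsetSum _ fun m _ => (hT.memLp_coeff l m).integrable_norm_pow (by norm_num)]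
  simp only [componentVariance, sq (component _ _ _ _)]
  exact_mod_cast h

theorem IsIsotropicGaussianField.summable_componentVariance (hT : IsIsotropicGaussianField T P) :
    Summable (componentVariance P T) := by
  have hi : ∀ l : ℕ, Integrable (fun ω => ∑ m ∈ Finset.Icc (-(l : ℤ)) l, ‖coeff T l m ω‖ ^ 2) P :=
    fun l => integrable_finsetSum _ fun m _ =>
      (hT.memLp_coeff l m).integrable_norm_pow (by norm_num)
  refine summable_of_sum_range_le (c := (4 * Real.pi)⁻¹ * ∫ ω, ∫ x, T x ω ^ 2 ∂surface ∂P)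
    (fun l => componentVariance_nonneg l) fun N => ?_
  refine (Finset.sum_le_sum_of_subset_of_nonneg (Finset.range_mono (Nat.le_succ N))
    fun l _ _ => componentVariance_nonneg l).trans ?_
  have hpi : (0 : ℝ) < 4 * Real.pi := by positivity
  rw [inv_mul_eq_div, le_div_iff₀ hpi, mul_comm, Finset.mul_sum]
  simp only [hT.componentVariance_eq]
  rw [← integral_finsetSum _ fun l _ => hi l]
  refine integral_mono_ae (integrable_finsetSum _ fun l _ => hi l)
    hT.integrable_sq_prod.integral_prod_right ?_
  filter_upwards [hT.ae_memLp] with ω hω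
  exact sum_norm_sq_coeff_le N ω hω

/-! ### The field defined by the series and its moments -/

theorem IsIsotropicGaussianField.memLp_component (hT : IsIsotropicGaussianField T P) (l : ℕ)
    (x : S2) : MemLp (component T l x) 2 P :=
  hT.memLp_fieldIntegral (continuous_zonal l x)

/-- The component of degree `l` at `x`, as an element of `L²`. -/
def componentLp (hT : IsIsotropicGaussianField T P) (l : ℕ) (x : S2) : Lp ℝ 2 P :=
  (hT.memLp_component l x).toLp (component T l x)

theorem coeFn_componentLp (hT : IsIsotropicGaussianField T P) (l : ℕ) (x : S2) :
    componentLp hT l x =ᵐ[P] component T l x :=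
  MemLp.coeFn_toLp _

theorem componentLp_mem (hT : IsIsotropicGaussianField T P) (l : ℕ) (x : S2) :
    componentLp hT l x ∈ gaussianSpan P T :=
  hT.toLp_fieldIntegral_mem (continuous_zonal l x)

theorem inner_componentLp (hT : IsIsotropicGaussianField T P) (l l' : ℕ) (x : S2) :
    inner ℝ (componentLp hT l x) (componentLp hT l' x) =
      if l = l' then componentVariance P T l else 0 := by
  rw [componentLp, componentLp, inner_toLp]
  split_ifs with h
  · subst h
    rw [hT.integral_component_mul, componentVariance]
    simp only [sq]
  · exact hT.integral_component_of_ne h x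

theorem norm_sq_sum_componentLp (hT : IsIsotropicGaussianField T P) (w : ℕ → ℝ) (x : S2)
    (s : Finset ℕ) :
    ‖∑ l ∈ s, w l • componentLp hT l x‖ ^ 2 = ∑ l ∈ s, w l ^ 2 * componentVariance P T l := by
  rw [← real_inner_self_eq_norm_sq, sum_inner]
  refine Finset.sum_congr rfl fun l hl => ?_
  simp only [inner_sum, real_inner_smul_left, real_inner_smul_right, inner_componentLp]
  simp [hl]
  ring

theorem summable_componentLp (hT : IsIsotropicGaussianField T P) {w : ℕ → ℝ}
    (hw : ∀ l, w l ∈ Set.Icc 0 1) (x : S2) : Summable fun l => w l • componentLp hT l x := by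
  have hs : Summable fun l => w l ^ 2 * componentVariance P T l :=
    hT.summable_componentVariance.of_nonneg_of_le
      (fun l => mul_nonneg (sq_nonneg _) (componentVariance_nonneg l))
      (fun l => mul_le_of_le_one_left (componentVariance_nonneg l)
        (pow_le_one₀ (hw l).1 (hw l).2))
  rw [summable_iff_vanishing_norm] at hs ⊢
  intro ε hε
  obtain ⟨s, hs⟩ := hs (ε ^ 2) (by positivity)
  refine ⟨s, fun t ht => ?_⟩
  have h := hs t ht
  rw [← norm_sq_sum_componentLp hT w x, Real.norm_of_nonneg (sq_nonneg _)] at h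
  exact lt_of_pow_lt_pow_left₀ 2 hε.le h

/-- The partial sums of the series defining the field. -/
def partialSum (hT : IsIsotropicGaussianField T P) (w : ℕ → ℝ) (x : S2) (N : ℕ) : Lp ℝ 2 P :=
  ∑ l ∈ Finset.range (N + 1), w l • componentLp hT l x

theorem partialSum_mem (hT : IsIsotropicGaussianField T P) (w : ℕ → ℝ) (x : S2) (N : ℕ) :
    partialSum hT w x N ∈ gaussianSpan P T :=
  Submodule.sum_mem _ fun l _ => Submodule.smul_mem _ _ (componentLp_mem hT l x)

theorem coeFn_partialSum (hT : IsIsotropicGaussianField T P) (w : ℕ → ℝ) (x : S2) (N : ℕ) :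
    partialSum hT w x N =ᵐ[P] fun ω => ∑ l ∈ Finset.range (N + 1), w l * component T l x ω := by
  have h : ∀ᵐ ω ∂P, ∀ l, (w l • componentLp hT l x : Lp ℝ 2 P) ω = w l * component T l x ω :=
    ae_all_iff.2 fun l => by
      filter_upwards [Lp.coeFn_smul (w l) (componentLp hT l x), coeFn_componentLp hT l x]
        with ω h1 h2
      rw [h1, Pi.smul_apply, h2, smul_eq_mul]
  filter_upwards [coeFn_sum (Finset.range (N + 1)) fun l => w l • componentLp hT l x, h]
    with ω h1 h2
  rw [partialSum, h1]
  simp only [h2]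

/-- The norms of the partial sums, hence the laws of the field, do not depend on the point of the
sphere. -/
theorem norm_partialSum_eq (hT : IsIsotropicGaussianField T P) (w : ℕ → ℝ) (x y : S2) (N : ℕ) :
    ‖partialSum hT w x N‖ = ‖partialSum hT w y N‖ := by
  rw [← sq_eq_sq₀ (norm_nonneg _) (norm_nonneg _), partialSum, partialSum,
    norm_sq_sum_componentLp, norm_sq_sum_componentLp]

theorem eLpNorm_sub_series (hT : IsIsotropicGaussianField T P) (w : ℕ → ℝ) (x : S2) (N : ℕ)
    {Z : Ω → ℝ} (hZ : MemLp Z 2 P) :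
    eLpNorm (fun ω => (Z ω : ℂ) -
        ∑ l ∈ Finset.range (N + 1), ∑ m ∈ Finset.Icc (-(l : ℤ)) (l : ℤ),
          coeff T l m ω * (w l : ℂ) * harmonic l m x) 2 P =
      ENNReal.ofReal ‖hZ.toLp Z - partialSum hT w x N‖ := by
  rw [Lp.norm_def, ENNReal.ofReal_toReal (Lp.eLpNorm_ne_top _)]
  refine eLpNorm_congr_norm_ae ?_
  filter_upwards [hT.ae_memLp, coeFn_partialSum hT w x N, hZ.coeFn_toLp,
    Lp.coeFn_sub (hZ.toLp Z) (partialSum hT w x N)] with ω h1 h2 h3 h4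
  rw [h4, Pi.sub_apply, h3, h2, ← Complex.norm_real]
  congr 1
  rw [Complex.ofReal_sub, Complex.ofReal_sum]
  congr 1
  refine Finset.sum_congr rfl fun l _ => ?_
  rw [Complex.ofReal_mul, ofReal_component l x ω h1, Finset.mul_sum]
  exact Finset.sum_congr rfl fun m _ => by ring

/-- Mean-square convergence of the complex series is convergence in the real `L²` space. -/
theorem isSeriesField_iff (hT : IsIsotropicGaussianField T P) (w : ℕ → ℝ) (X : S2 → Ω → ℝ) :
    IsSeriesField P T w X ↔ ∀ x, ∃ h : MemLp (X x) 2 P,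
      Tendsto (partialSum hT w x) atTop (𝓝 (h.toLp (X x))) := by
  refine forall_congr' fun x => ?_
  rw [← exists_prop]
  refine exists_congr fun h => ?_
  simp only [eLpNorm_sub_series hT w x _ h]
  rw [tendsto_iff_norm_sub_tendsto_zero]
  simp only [norm_sub_rev _ (h.toLp (X x))]
  constructor
  · intro h1
    have := (ENNReal.tendsto_toReal ENNReal.zero_ne_top).comp h1
    simpa [Function.comp_def] using this
  · intro h1
    simpa using ENNReal.tendsto_ofReal h1

theorem exists_isSeriesField (hT : IsIsotropicGaussianField T P) {w : ℕ → ℝ}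
    (hw : ∀ l, w l ∈ Set.Icc 0 1) : ∃ X : S2 → Ω → ℝ, IsSeriesField P T w X := by
  refine ⟨fun x => (∑' l, w l • componentLp hT l x : Lp ℝ 2 P), ?_⟩
  rw [isSeriesField_iff hT]
  refine fun x => ⟨Lp.memLp _, ?_⟩
  rw [Lp.toLp_coeFn]
  exact (tendsto_add_atTop_iff_nat 1).2 (summable_componentLp hT hw x).hasSum.tendsto_sum_nat

omit [MeasurableSpace Ω] in
/-- The normalized zonal coefficient `√((2l+1)/(4π)) a_{l0}` is the component at the pole. -/
theorem component_pole (l : ℕ) (ω : Ω) :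
    (component T l pole ω : ℂ) =
      (Real.sqrt ((2 * l + 1) / (4 * Real.pi)) : ℂ) * coeff T l 0 ω := by
  have hz : ∀ y, ((zonal l pole y : ℝ) : ℂ) =
      (Real.sqrt ((2 * l + 1) / (4 * Real.pi)) : ℂ) * (starRingEnd ℂ) (harmonic l 0 y) := by
    intro y
    rw [ofReal_zonal, zonalC]
    simp only [harmonic_pole]
    simp
  rw [component, fieldIntegral, ← integral_complex_ofReal, coeff, ← integral_const_mul]
  congr 1; ext y
  rw [Complex.ofReal_mul, hz]
  ring

omit [MeasurableSpace Ω] in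
theorem coeff_zero_eq (l : ℕ) (ω : Ω) :
    coeff T l 0 ω =
      (((Real.sqrt ((2 * l + 1) / (4 * Real.pi)))⁻¹ * component T l pole ω : ℝ) : ℂ) := by
  have h : Real.sqrt ((2 * (l : ℝ) + 1) / (4 * Real.pi)) ≠ 0 :=
    (Real.sqrt_pos.2 (by positivity)).ne'
  have h' : (Real.sqrt ((2 * (l : ℝ) + 1) / (4 * Real.pi)) : ℂ) ≠ 0 := by exact_mod_cast h
  rw [Complex.ofReal_mul, component_pole, Complex.ofReal_inv, inv_mul_cancel_left₀ h']

theorem ae_prod_componentLp (hT : IsIsotropicGaussianField T P) {n : ℕ} (l : Fin n → ℕ) :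
    (fun ω => ∏ j, componentLp hT (l j) pole ω) =ᵐ[P] fun ω => ∏ j, component T (l j) pole ω := by
  have h : ∀ᵐ ω ∂P, ∀ j, componentLp hT (l j) pole ω = component T (l j) pole ω :=
    ae_all_iff.2 fun j => coeFn_componentLp hT (l j) pole
  filter_upwards [h] with ω h
  simp only [h]

theorem integrable_prod_component (hT : IsIsotropicGaussianField T P) {n : ℕ} (l : Fin n → ℕ) :
    Integrable (fun ω => ∏ j, component T (l j) pole ω) P :=
  (integrable_prod_of_mem_gaussianSpan hT.gaussian hT.mean_zero
    fun j => componentLp_mem hT (l j) pole).congr (ae_prod_componentLp hT l)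

theorem integrable_prod_coeff (hT : IsIsotropicGaussianField T P) {n : ℕ} (l : Fin n → ℕ) :
    Integrable (fun ω => ∏ j, coeff T (l j) 0 ω) P := by
  have e : (fun ω => ∏ j, coeff T (l j) 0 ω) = fun ω =>
      (((∏ j, (Real.sqrt ((2 * (l j : ℝ) + 1) / (4 * Real.pi)))⁻¹) *
        ∏ j, component T (l j) pole ω : ℝ) : ℂ) := by
    ext ω
    simp only [coeff_zero_eq]
    rw [← Finset.prod_mul_distrib, Complex.ofReal_prod]
  rw [e]
  exact ((integrable_prod_component hT l).const_mul _).ofReal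

omit [IsProbabilityMeasure P] in
/-- The terms of the moment series are the mixed moments of the components at the pole. -/
theorem momentTerm_eq (w : ℕ → ℝ) {n : ℕ} (l : Fin n → ℕ) :
    (((∏ j, w (l j)) * Real.sqrt ((∏ j, (2 * (l j : ℝ) + 1)) / (4 * Real.pi) ^ n) : ℝ) : ℂ) *
        ∫ ω, ∏ j, coeff T (l j) 0 ω ∂P =
      (((∏ j, w (l j)) * ∫ ω, ∏ j, component T (l j) pole ω ∂P : ℝ) : ℂ) := by
  have hs : Real.sqrt ((∏ j, (2 * (l j : ℝ) + 1)) / (4 * Real.pi) ^ n) =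
      ∏ j, Real.sqrt ((2 * (l j : ℝ) + 1) / (4 * Real.pi)) := by
    rw [← Real.sqrt_prod _ fun j _ => by positivity, Finset.prod_div_distrib]
    simp
  rw [hs, Complex.ofReal_mul, mul_assoc, Complex.ofReal_mul (∏ j, w (l j)),
    ← integral_complex_ofReal, ← integral_const_mul]
  congr 2; ext ω
  simp only [Complex.ofReal_prod, component_pole, Finset.prod_mul_distrib]

theorem integral_prod_component_nonneg (hT : IsIsotropicGaussianField T P) {n : ℕ}
    (l : Fin n → ℕ) : 0 ≤ ∫ ω, ∏ j, component T (l j) pole ω ∂P := by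
  rw [← integral_congr_ae (ae_prod_componentLp hT l)]
  refine integral_prod_nonneg_of_mem_gaussianSpan hT.gaussian hT.mean_zero
    (Z := fun l => componentLp hT l pole) (fun l => componentLp_mem hT l pole) ?_ l
  intro j k hjk
  rw [inner_componentLp, if_neg hjk]

/-- The box sums of the moment series are the moments of the partial sums of the field. -/
theorem sum_box_eq (hT : IsIsotropicGaussianField T P) (w : ℕ → ℝ) (n N : ℕ) :
    ∑ l ∈ Fintype.piFinset fun _ : Fin n => Finset.range (N + 1),
        (∏ j, w (l j)) * ∫ ω, ∏ j, component T (l j) pole ω ∂P =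
      ∫ ω, partialSum hT w pole N ω ^ n ∂P := by
  have e : (fun ω => partialSum hT w pole N ω ^ n) =ᵐ[P] fun ω =>
      ∑ l ∈ Fintype.piFinset fun _ : Fin n => Finset.range (N + 1),
        (∏ j, w (l j)) * ∏ j, component T (l j) pole ω := by
    filter_upwards [coeFn_partialSum hT w pole N] with ω h
    rw [h, ← Fin.prod_const, Finset.prod_univ_sum]
    simp only [Finset.prod_mul_distrib]
  rw [integral_congr_ae e, integral_finsetSum _ fun l _ =>
    (integrable_prod_component hT l).const_mul _]
  simp only [integral_const_mul]

theorem tendsto_box (n : ℕ) :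
    Tendsto (fun N => Fintype.piFinset fun _ : Fin n => Finset.range (N + 1)) atTop atTop := by
  refine tendsto_atTop_finset_of_monotone (fun N M h => ?_) fun l => ?_
  · exact Fintype.piFinset_subset _ _ fun _ => Finset.range_mono (by omega)
  · refine ⟨∑ j, l j, Fintype.mem_piFinset.2 fun j => Finset.mem_range.2 ?_⟩
    have := Finset.single_le_sum (f := l) (fun _ _ => Nat.zero_le _) (Finset.mem_univ j)
    omega

theorem hasSum_of_tendsto_box {n : ℕ} {F : (Fin n → ℕ) → ℝ} (hF : ∀ l, 0 ≤ F l) {a : ℝ}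
    (h : Tendsto (fun N => ∑ l ∈ Fintype.piFinset fun _ : Fin n => Finset.range (N + 1), F l)
      atTop (𝓝 a)) : HasSum F a := by
  have hmono : Monotone fun N =>
      ∑ l ∈ Fintype.piFinset fun _ : Fin n => Finset.range (N + 1), F l := fun N M hNM =>
    Finset.sum_le_sum_of_subset_of_nonneg
      (Fintype.piFinset_subset _ _ fun _ => Finset.range_mono (by omega)) fun l _ _ => hF l
  have hs : Summable F := by
    refine summable_of_sum_le hF (c := a) fun u => ?_
    obtain ⟨N, hN⟩ := ((tendsto_box n).eventually_ge_atTop u).exists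
    exact (Finset.sum_le_sum_of_subset_of_nonneg hN fun l _ _ => hF l).trans
      (hmono.ge_of_tendsto h N)
  have := tendsto_nhds_unique (hs.hasSum.comp (tendsto_box n)) h
  exact this ▸ hs.hasSum

theorem mem_gaussianSpan_of_tendsto (hT : IsIsotropicGaussianField T P) {w : ℕ → ℝ}
    {x : S2} {Z : Lp ℝ 2 P} (hZ : Tendsto (partialSum hT w x) atTop (𝓝 Z)) :
    Z ∈ gaussianSpan P T :=
  (Submodule.isClosed_topologicalClosure _).mem_of_tendsto hZ
    (Eventually.of_forall fun N => partialSum_mem hT w x N)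

/-- The `n`-th moment is the limit of the moments of the partial sums. These are Gaussian with the
same law at `x` and at the pole, and at the pole they are box sums of the nonnegative
moment series. -/
theorem moments_of_isSeriesField (hT : IsIsotropicGaussianField T P) {w : ℕ → ℝ}
    (hw : ∀ l, w l ∈ Set.Icc 0 1) {X : S2 → Ω → ℝ} (hX : IsSeriesField P T w X) (n : ℕ) (x : S2) :
    Integrable (fun ω => X x ω ^ n) P ∧
      HasSum (fun l : Fin n → ℕ => (∏ j, w (l j)) * ∫ ω, ∏ j, component T (l j) pole ω ∂P)
        (∫ ω, X x ω ^ n ∂P) := by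
  obtain ⟨h, hlim⟩ := (isSeriesField_iff hT w X).1 hX x
  have hmem := mem_gaussianSpan_of_tendsto hT hlim
  have hae : (fun ω => h.toLp (X x) ω ^ n) =ᵐ[P] fun ω => X x ω ^ n := by
    filter_upwards [h.coeFn_toLp] with ω h1
    rw [h1]
  constructor
  · have := integrable_prod_of_mem_gaussianSpan hT.gaussian hT.mean_zero
      (Z := fun _ : Fin n => h.toLp (X x)) fun _ => hmem
    simp only [Fin.prod_const] at this
    exact this.congr hae
  · refine hasSum_of_tendsto_box (fun l => mul_nonneg
      (Finset.prod_nonneg fun j _ => (hw _).1) (integral_prod_component_nonneg hT l)) ?_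
    rw [← integral_congr_ae hae,
      integral_pow_of_mem_gaussianSpan hT.gaussian hT.mean_zero hmem]
    simp only [sum_box_eq hT, integral_pow_of_mem_gaussianSpan hT.gaussian hT.mean_zero
      (partialSum_mem hT w pole _), norm_partialSum_eq hT w pole x]
    exact (hlim.norm.pow n).mul_const _

end Field

end SphericalField

end

theorem proposition2 {Ω Ω' : Type*} [MeasurableSpace Ω] [MeasurableSpace Ω']
    (P : Measure Ω) [IsProbabilityMeasure P] (Q : Measure Ω') [IsProbabilityMeasure Q]
    -- the initial field
    (T : SphericalField.S2 → Ω → ℝ) (hT : SphericalField.IsIsotropicGaussianField T P)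
    -- the subordinator governing the time variable, without drift, with Lévy measure `ν`
    (ν : Measure ℝ) (hν : SphericalField.IsLevyMeasure ν) (hν_infinite : ν (Set.Ioi 0) = ∞)
    (hν_tail : ∀ c d : ℝ, 0 < c → c ≤ d →
      AbsolutelyContinuousOnInterval (SphericalField.tail ν) c d)
    (H : ℝ≥0 → Ω' → ℝ)
    (hH : SphericalField.IsSubordinator H Q (SphericalField.bernstein 0 ν))
    -- the Bernstein function governing the space variable
    (b : ℝ) (hb : 0 ≤ b) (M : Measure ℝ) (hM : SphericalField.IsLevyMeasure M)
    (γ : ℝ) (hγ : 0 ≤ γ) (t : ℝ) (ht : 0 ≤ t)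
    -- `w l` is the Laplace transform of `L_t` at `γ + Ψ(μ_l)`
    (w : ℕ → ℝ)
    (hw : ∀ l, w l = SphericalField.inverseLaplace H Q t
      (γ + SphericalField.bernstein b M (SphericalField.eigenvalue l))) :
    (∃ X : SphericalField.S2 → Ω → ℝ, SphericalField.IsSeriesField P T w X) ∧
    ∀ X : SphericalField.S2 → Ω → ℝ, SphericalField.IsSeriesField P T w X →
      ∀ (n : ℕ) (g : SphericalField.SO3) (x : SphericalField.S2),
        Integrable (fun ω => X (SphericalField.rotate g x) ω ^ n) P ∧
        (∀ l : Fin n → ℕ, Integrable (fun ω => ∏ j, SphericalField.coeff T (l j) 0 ω) P) ∧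
        HasSum (fun l : Fin n → ℕ =>
            (((∏ j, w (l j)) *
              Real.sqrt ((∏ j, (2 * (l j : ℝ) + 1)) / (4 * Real.pi) ^ n) : ℝ) : ℂ) *
              ∫ ω, ∏ j, SphericalField.coeff T (l j) 0 ω ∂P)
          ((∫ ω, X (SphericalField.rotate g x) ω ^ n ∂P : ℝ) : ℂ) ∧
        ∫ ω, X (SphericalField.rotate g x) ω ^ n ∂P = ∫ ω, X x ω ^ n ∂P := by
  have hw01 : ∀ l, w l ∈ Set.Icc 0 1 := fun l => by
    rw [hw l]
    refine SphericalField.inverseLaplace_mem_Icc H Q t (add_nonneg hγ ?_)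
    exact SphericalField.bernstein_nonneg hb hM (by unfold SphericalField.eigenvalue; positivity)
  refine ⟨SphericalField.exists_isSeriesField hT hw01, fun X hX n g x => ?_⟩
  obtain ⟨h1, h2⟩ := SphericalField.moments_of_isSeriesField hT hw01 hX n
    (SphericalField.rotate g x)
  obtain ⟨-, h3⟩ := SphericalField.moments_of_isSeriesField hT hw01 hX n x
  refine ⟨h1, SphericalField.integrable_prod_coeff hT, ?_, h2.unique h3⟩
  simp only [SphericalField.momentTerm_eq]
  exact Complex.hasSum_ofReal.2 h2
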